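/- For a real random variable $X$ with $0<\sigma_X^2=\mathrm{Var}(X)<\infty$ and $0<D<\sigma_X^2$ let $$R_X(D)=\inf\{I(X;Y): P_{Y|X}\text{ a channel from }\mathbb R\text{ to }\mathbb R,\ \mathbb E[(X-Y)^2]\le D\}$$ be its rate-distortion function (RDF) under squared error, and let $R_X^{\mathrm{add}}(D)=I(X;X+N)$ be its additive RDF, where $N\sim\mathcal N(0,\theta)$ is independent of $X$ and $\theta\in(0,\infty)$ is the noise variance for which $\mathbb E[(\mathbb E[X|X+N]-X)^2]=D$. The multiplicative rate loss of the additive RDF at zero rate, $\lim_{D\uparrow\sigma_X^2}R_X^{\mathrm{add}}(D)/R_X(D)$, can be unbounded: (1) Fix $\sigma_X^2>0$ and $\lambda\in(0,1)$. For $\sigma_1^2>\sigma_X^2$ let $X$ have the two-component Gaussian mixture law $P_0\,\mathcal N(0,\sigma_0^2)+P_1\,\mathcal N(0,\sigma_1^2)$ with $P_0,P_1>0$, $P_0+P_1=1$, $P_0\sigma_0^2=\lambda\sigma_X^2$ and $P_1\sigma_1^2=(1-\lambda)\sigma_X^2$; these conditions determine $P_0,P_1,\sigma_0^2$, with $0<\sigma_0^2<\sigma_1^2$,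 and $X$ has variance $\sigma_X^2$. Then the limit $$L(\sigma_1^2)=\lim_{D\uparrow\sigma_X^2}\frac{R_X^{\mathrm{add}}(D)}{R_X(D)}$$ exists and is finite for every $\sigma_1^2>\sigma_X^2$, and $L(\sigma_1^2)\to\infty$ as $\sigma_1^2\to\infty$. (2) There is a single source $X$ of finite positive variance $\sigma_X^2$ with $$\lim_{D\uparrow\sigma_X^2}\frac{R_X^{\mathrm{add}}(D)}{R_X(D)}=\infty.$$ -/

import Mathlib

open MeasureTheory ProbabilityTheory InformationTheory Filter Topology
open scoped NNReal ENNReal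

noncomputable section

/-- The mutual information `I(X;Y)` (in nats, with values in `[0,∞]`): the Kullback-Leibler
divergence of the joint law of `X` and `Y` from the product of their laws. -/
def mutualInfo {Ω α β : Type*} [MeasurableSpace Ω] [MeasurableSpace α] [MeasurableSpace β]
    (P : Measure Ω) (X : Ω → α) (Y : Ω → β) : ℝ≥0∞ :=
  klDiv (P.map (fun ω => (X ω, Y ω))) ((P.map X).prod (P.map Y))

/-- `var(X|Y) = E[(E[X|Y] - X)²]`, the minimum mean squared error in estimating `X` from `Y`. -/
def minMSE {Ω β : Type*} [MeasurableSpace Ω] [mβ : MeasurableSpace β]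
    (P : Measure Ω) (X : Ω → ℝ) (Y : Ω → β) : ℝ :=
  ∫ ω, ((P[X | MeasurableSpace.comap Y mβ]) ω - X ω) ^ 2 ∂P

/-- Shannon's rate-distortion function `R_X(D)` under squared error of a real source `X` with
law `μ`: the infimum of `I(X;Y)` over all channels `κ` from `X` to a real reproduction `Y` with
`E[(X - Y)²] ≤ D`. -/
def rdf (μ : Measure ℝ) (D : ℝ) : ℝ≥0∞ :=
  ⨅ (κ : Kernel ℝ ℝ) (_ : IsMarkovKernel κ)
    (_ : ∫⁻ p, ENNReal.ofReal ((p.1 - p.2) ^ 2) ∂(μ ⊗ₘ κ) ≤ ENNReal.ofReal D),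
    mutualInfo (μ ⊗ₘ κ) Prod.fst Prod.snd

/-- The additive RDF `R_X^add(D)` of a real source `X` with law `μ`: the value `I(X;X+N)`,
where `N ∼ N(0,θ)` is independent of `X` and `0 < θ < ∞` is chosen such that `var(X|X+N) = D`.
For a source of positive finite variance and `0 < D < Var X` there is exactly one such `θ`, so
the infimum is over a single value; it is `∞` where no `θ` gives the distortion `D`. -/
def additiveRDF (μ : Measure ℝ) (D : ℝ) : ℝ≥0∞ :=
  ⨅ (θ : ℝ≥0) (_ : 0 < θ)
    (_ : minMSE (μ.prod (gaussianReal 0 θ)) Prod.fst (fun p => p.1 + p.2) = D),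
    mutualInfo (μ.prod (gaussianReal 0 θ)) Prod.fst (fun p => p.1 + p.2)

/-- The multiplicative rate loss `R_X^add(D) / R_X(D)` as a real number. The value is `0`
when one of the two rates is infinite or `R_X(D) = 0`, so a positive limit of it, or a limit `+∞`,
is never due to such a degenerate quotient. -/
def multiplicativeRateLoss (μ : Measure ℝ) (D : ℝ) : ℝ :=
  (additiveRDF μ D).toReal / (rdf μ D).toReal

/-- The two-component Gaussian mixture `P₀ N(0,v₀) + P₁ N(0,v₁)`; `v₀`, `v₁` are variances. -/
def gaussianMixture (P₀ P₁ v₀ v₁ : ℝ≥0) : Measure ℝ :=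
  P₀ • gaussianReal 0 v₀ + P₁ • gaussianReal 0 v₁

end

noncomputable section

theorem klDiv_map_measurableEquiv {α β : Type*} [MeasurableSpace α] [MeasurableSpace β]
    (e : α ≃ᵐ β) (μ ν : Measure α) [IsFiniteMeasure μ] [IsFiniteMeasure ν] :
    klDiv (μ.map e) (ν.map e) = klDiv μ ν := by
  refine le_antisymm (klDiv_map_le μ ν e.measurable) ?_
  have h := klDiv_map_le (μ.map e) (ν.map e) e.symm.measurable
  simpa using h

theorem klDiv_withDensity_exp {α : Type*} [MeasurableSpace α] {P Q : Measure α}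
    [IsProbabilityMeasure P] [IsProbabilityMeasure Q] {f : α → ℝ} (hf : Measurable f)
    (hP : P = Q.withDensity fun a => ENNReal.ofReal (Real.exp (f a))) (hint : Integrable f P) :
    klDiv P Q = ENNReal.ofReal (∫ a, f a ∂P) := by
  have hac : P ≪ Q := hP ▸ withDensity_absolutelyContinuous _ _
  have hllr : llr P Q =ᵐ[P] f := by
    have h : P.rnDeriv Q =ᵐ[Q] fun a => ENNReal.ofReal (Real.exp (f a)) := by
      rw [hP]
      exact Measure.rnDeriv_withDensity Q (by fun_prop)
    filter_upwards [hac.ae_le h] with a ha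
    rw [llr, ha, ENNReal.toReal_ofReal (Real.exp_pos _).le, Real.log_exp]
  rw [klDiv_of_ac_of_integrable hac ((integrable_congr hllr).2 hint), integral_congr_ae hllr]
  simp

/-- The density `dN(x,θ)/dN(0,θ)` at `y`. -/
def gaussKer (θ : ℝ≥0) (x y : ℝ) : ℝ := Real.exp ((x * y - x ^ 2 / 2) / θ)

theorem gaussKer_pos (θ : ℝ≥0) (x y : ℝ) : 0 < gaussKer θ x y := Real.exp_pos _

@[fun_prop]
theorem measurable_gaussKer (θ : ℝ≥0) : Measurable (fun p : ℝ × ℝ => gaussKer θ p.1 p.2) := by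
  unfold gaussKer
  fun_prop

theorem gaussKer_le (θ : ℝ≥0) (x y : ℝ) : gaussKer θ x y ≤ Real.exp (y ^ 2 / 2 / θ) := by
  refine Real.exp_le_exp.2 (div_le_div_of_nonneg_right ?_ θ.2)
  nlinarith [sq_nonneg (x - y)]

theorem gaussianReal_eq_withDensity {θ : ℝ≥0} (hθ : θ ≠ 0) (x : ℝ) :
    gaussianReal x θ =
      (gaussianReal 0 θ).withDensity (fun y => ENNReal.ofReal (gaussKer θ x y)) := by
  rw [gaussianReal_of_var_ne_zero _ hθ, gaussianReal_of_var_ne_zero _ hθ,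
    ← withDensity_mul _ (measurable_gaussianPDF 0 θ) (by unfold gaussKer; fun_prop)]
  congr 1
  ext y
  have hθ' : (θ : ℝ) ≠ 0 := by exact_mod_cast hθ
  simp only [gaussianPDF, Pi.mul_apply]
  rw [← ENNReal.ofReal_mul (gaussianPDFReal_nonneg _ _ _)]
  congr 1
  rw [gaussianPDFReal, gaussianPDFReal, gaussKer, mul_assoc (√_)⁻¹ (Real.exp _) (Real.exp _), ← Real.exp_add]
  congr 2
  field_simp
  ring

theorem map_fst_add_eq_withDensity {μ : Measure ℝ} [SFinite μ] {θ : ℝ≥0} (hθ : θ ≠ 0) :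
    (μ.prod (gaussianReal 0 θ)).map (fun p => (p.1, p.1 + p.2)) =
      (μ.prod (gaussianReal 0 θ)).withDensity
        (fun p => ENNReal.ofReal (gaussKer θ p.1 p.2)) := by
  refine Measure.ext_of_lintegral _ fun f hf => ?_
  have hd : Measurable fun p : ℝ × ℝ => ENNReal.ofReal (gaussKer θ p.1 p.2) := by fun_prop
  rw [lintegral_map hf (by fun_prop), lintegral_withDensity_eq_lintegral_mul _ hd hf,
    lintegral_prod _ (by fun_prop), lintegral_prod _ (by fun_prop)]
  refine lintegral_congr fun x => ?_
  have h1 : ∫⁻ n, f (x, x + n) ∂gaussianReal 0 θ = ∫⁻ y, f (x, y) ∂gaussianReal x θ := by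
    have := gaussianReal_map_const_add (μ := 0) (v := θ) x
    rw [zero_add] at this
    rw [← this, lintegral_map (by fun_prop) (by fun_prop)]
  rw [h1, gaussianReal_eq_withDensity hθ,
    lintegral_withDensity_eq_lintegral_mul _ (by unfold gaussKer; fun_prop) (by fun_prop)]
  rfl

section Channel

variable {μ : Measure ℝ} [IsProbabilityMeasure μ] {θ : ℝ≥0}

theorem integrable_gaussKer (θ : ℝ≥0) (y : ℝ) : Integrable (fun x => gaussKer θ x y) μ :=
  Integrable.of_bound (by unfold gaussKer; fun_prop) (Real.exp (y ^ 2 / 2 / θ))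
    (ae_of_all _ fun x => by
      rw [Real.norm_of_nonneg (gaussKer_pos θ x y).le]; exact gaussKer_le θ x y)

/-- The density of the law of `X + N` with respect to the law of `N`. -/
def outDensity (μ : Measure ℝ) (θ : ℝ≥0) (y : ℝ) : ℝ := ∫ x, gaussKer θ x y ∂μ

theorem outDensity_pos (μ : Measure ℝ) [IsProbabilityMeasure μ] (θ : ℝ≥0) (y : ℝ) :
    0 < outDensity μ θ y := by
  refine (integral_pos_iff_support_of_nonneg (fun x => (gaussKer_pos θ x y).le)
    (integrable_gaussKer θ y)).2 ?_
  have : Function.support (fun x => gaussKer θ x y) = Set.univ := by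
    ext x; simpa using (gaussKer_pos θ x y).ne'
  simp [this]

@[fun_prop]
theorem measurable_outDensity (μ : Measure ℝ) [IsProbabilityMeasure μ] (θ : ℝ≥0) :
    Measurable (outDensity μ θ) := by
  have h : StronglyMeasurable fun p : ℝ × ℝ => gaussKer θ p.2 p.1 := by
    unfold gaussKer; exact Measurable.stronglyMeasurable (by fun_prop)
  exact h.integral_prod_right.measurable

theorem map_add_eq_withDensity (hθ : θ ≠ 0) :
    (μ.prod (gaussianReal 0 θ)).map (fun p => p.1 + p.2) =
      (gaussianReal 0 θ).withDensity (fun y => ENNReal.ofReal (outDensity μ θ y)) := by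
  have h : (μ.prod (gaussianReal 0 θ)).map (fun p => p.1 + p.2) =
      ((μ.prod (gaussianReal 0 θ)).map (fun p => (p.1, p.1 + p.2))).map Prod.snd := by
    rw [Measure.map_map (by fun_prop) (by fun_prop)]; rfl
  have hd : Measurable fun p : ℝ × ℝ => ENNReal.ofReal (gaussKer θ p.1 p.2) := by fun_prop
  rw [h, map_fst_add_eq_withDensity hθ]
  refine Measure.ext_of_lintegral _ fun f hf => ?_
  rw [lintegral_map hf (by fun_prop), lintegral_withDensity_eq_lintegral_mul _ hd (by fun_prop),
    lintegral_withDensity_eq_lintegral_mul _ (by fun_prop) hf, lintegral_prod_symm _ (by fun_prop)]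
  refine lintegral_congr fun y => ?_
  simp only [Pi.mul_apply]
  rw [lintegral_mul_const _ (by unfold gaussKer; fun_prop), outDensity,
    ofReal_integral_eq_lintegral_ofReal (integrable_gaussKer θ y)
      (ae_of_all _ fun x => (gaussKer_pos θ x y).le)]

theorem mutualInfo_add_klDiv (hθ : θ ≠ 0) (hm : MemLp id 2 μ) (h0 : ∫ x, x ∂μ = 0) :
    mutualInfo (μ.prod (gaussianReal 0 θ)) Prod.fst (fun p => p.1 + p.2) +
      klDiv ((μ.prod (gaussianReal 0 θ)).map (fun p => p.1 + p.2)) (gaussianReal 0 θ) =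
      ENNReal.ofReal ((∫ x, x ^ 2 ∂μ) / (2 * θ)) := by
  set γ := gaussianReal 0 θ
  set Y : ℝ × ℝ → ℝ := fun p => p.1 + p.2
  have hY : Measurable Y := by fun_prop
  set J := (μ.prod γ).map (fun p => (p.1, Y p)) with hJ
  set ν := (μ.prod γ).map Y with hν
  have : IsProbabilityMeasure J := Measure.isProbabilityMeasure_map (by fun_prop)
  have : IsProbabilityMeasure ν := Measure.isProbabilityMeasure_map (by fun_prop)
  have hsw : J.map Prod.swap = ν ⊗ₘ condDistrib Prod.fst Y (μ.prod γ) := by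
    rw [hν, compProd_map_condDistrib (by fun_prop), hJ,
      Measure.map_map (by fun_prop) (by fun_prop)]
    rfl
  have e1 : klDiv J (μ.prod γ) = klDiv (J.map Prod.swap) (γ.prod μ) := by
    have := klDiv_map_measurableEquiv MeasurableEquiv.prodComm J (μ.prod γ)
    rw [← this, ← Measure.prod_swap (μ := μ) (ν := γ)]
    rfl
  have e2 : klDiv J (μ.prod ν) = klDiv (J.map Prod.swap) (ν.prod μ) := by
    have := klDiv_map_measurableEquiv MeasurableEquiv.prodComm J (μ.prod ν)
    rw [← this, ← Measure.prod_swap (μ := μ) (ν := ν)]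
    rfl
  have hmi : mutualInfo (μ.prod γ) Prod.fst Y = klDiv J (μ.prod ν) := by
    rw [mutualInfo, Measure.map_fst_prod]
    simp [hJ, hν]
  have chain := klDiv_compProd_eq_add ν γ (condDistrib Prod.fst Y (μ.prod γ))
    (Kernel.const ℝ μ)
  rw [← hsw, Measure.compProd_const, Measure.compProd_const] at chain
  rw [hmi, e2, add_comm, ← chain, ← e1]
  have i1 : Integrable (fun x => x) μ := hm.integrable (by norm_num)
  have i2 : Integrable (fun x => x ^ 2) μ := hm.integrable_sq
  have j1 : Integrable (fun x => x) γ := (memLp_id_gaussianReal 1).integrable (by simp)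
  have hθ' : (θ : ℝ) ≠ 0 := by exact_mod_cast hθ
  have hf : Measurable fun p : ℝ × ℝ => (p.1 * p.2 - p.1 ^ 2 / 2) / (θ : ℝ) := by fun_prop
  have hcomp : ∀ p : ℝ × ℝ, (p.1 * Y p - p.1 ^ 2 / 2) / (θ : ℝ) =
      p.1 ^ 2 / (2 * θ) + p.1 * p.2 / θ := fun p => by
    simp only [Y]; field_simp; ring
  have k1 : Integrable (fun p : ℝ × ℝ => p.1 ^ 2 / (2 * (θ : ℝ))) (μ.prod γ) :=
    (i2.comp_fst γ).div_const _
  have k2 : Integrable (fun p : ℝ × ℝ => p.1 * p.2 / (θ : ℝ)) (μ.prod γ) :=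
    (i1.mul_prod j1).div_const _
  rw [klDiv_withDensity_exp (P := J) hf (map_fst_add_eq_withDensity hθ)]
  · rw [hJ, integral_map (by fun_prop) hf.aestronglyMeasurable]
    simp only [hcomp]
    rw [integral_add k1 k2, integral_div, integral_div, integral_prod_mul (fun x => x) fun x => x,
      h0, integral_fun_fst (fun x : ℝ => x ^ 2)]
    simp
  · rw [hJ, integrable_map_measure hf.aestronglyMeasurable (by fun_prop)]
    exact (k1.add k2).congr (ae_of_all _ fun p => (hcomp p).symm)

theorem toReal_klDiv_map_add (hθ : θ ≠ 0) :
    (klDiv ((μ.prod (gaussianReal 0 θ)).map (fun p => p.1 + p.2)) (gaussianReal 0 θ)).toReal =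
      ∫ y, klFun (outDensity μ θ y) ∂gaussianReal 0 θ := by
  have : IsProbabilityMeasure ((μ.prod (gaussianReal 0 θ)).map (fun p => p.1 + p.2)) :=
    Measure.isProbabilityMeasure_map (by fun_prop)
  have hac : (μ.prod (gaussianReal 0 θ)).map (fun p => p.1 + p.2) ≪ gaussianReal 0 θ := by
    rw [map_add_eq_withDensity hθ]; exact withDensity_absolutelyContinuous _ _
  rw [toReal_klDiv_eq_integral_klFun hac]
  refine integral_congr_ae ?_
  rw [map_add_eq_withDensity hθ]
  filter_upwards [Measure.rnDeriv_withDensity (gaussianReal 0 θ)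
    (f := fun y => ENNReal.ofReal (outDensity μ θ y)) (by fun_prop)] with y hy
  rw [hy, ENNReal.toReal_ofReal (outDensity_pos μ θ y).le]

end Channel

theorem minMSE_eq_variance_sub {Ω β : Type*} [MeasurableSpace Ω] [mβ : MeasurableSpace β]
    {P : Measure Ω} [IsProbabilityMeasure P] {X : Ω → ℝ} {Y : Ω → β}
    (hX : MemLp X 2 P) (hY : Measurable Y) :
    minMSE P X Y = Var[X; P] - Var[P[X | MeasurableSpace.comap Y mβ]; P] := by
  rw [← integral_condVar_add_variance_condExp hY.comap_le hX, condVar,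
    integral_condExp hY.comap_le, minMSE, add_sub_cancel_right]
  refine integral_congr_ae (ae_of_all _ fun p => ?_)
  simp only [Pi.pow_apply, Pi.sub_apply]
  ring

section PosteriorMean

variable {μ : Measure ℝ} [IsProbabilityMeasure μ] {θ : ℝ≥0}

theorem integral_comp_fst_add (hθ : θ ≠ 0) {f : ℝ × ℝ → ℝ} (hf : Measurable f)
    (hint : Integrable (fun p : ℝ × ℝ => f (p.1, p.1 + p.2)) (μ.prod (gaussianReal 0 θ))) :
    Integrable (fun y => ∫ x, f (x, y) * gaussKer θ x y ∂μ) (gaussianReal 0 θ) ∧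
    ∫ p : ℝ × ℝ, f (p.1, p.1 + p.2) ∂μ.prod (gaussianReal 0 θ) =
      ∫ y, ∫ x, f (x, y) * gaussKer θ x y ∂μ ∂gaussianReal 0 θ := by
  have hd : Measurable fun p : ℝ × ℝ => (gaussKer θ p.1 p.2).toNNReal := by fun_prop
  have hg : Measurable fun p : ℝ × ℝ => (p.1, p.1 + p.2) := by fun_prop
  have hmap : (μ.prod (gaussianReal 0 θ)).map (fun p => (p.1, p.1 + p.2)) =
      (μ.prod (gaussianReal 0 θ)).withDensity
        (fun p => ((gaussKer θ p.1 p.2).toNNReal : ℝ≥0∞)) := map_fst_add_eq_withDensity hθ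
  have hcoe : ∀ p : ℝ × ℝ, (gaussKer θ p.1 p.2).toNNReal • f p = f p * gaussKer θ p.1 p.2 :=
    fun p => by
      rw [NNReal.smul_def, smul_eq_mul, Real.coe_toNNReal _ (gaussKer_pos _ _ _).le, mul_comm]
  have h1 : Integrable f ((μ.prod (gaussianReal 0 θ)).map (fun p => (p.1, p.1 + p.2))) :=
    (integrable_map_measure hf.aestronglyMeasurable hg.aemeasurable).2 hint
  have h2 : Integrable (fun p : ℝ × ℝ => f p * gaussKer θ p.1 p.2)
      (μ.prod (gaussianReal 0 θ)) := by
    rw [hmap, integrable_withDensity_iff_integrable_smul hd] at h1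
    exact h1.congr (ae_of_all _ hcoe)
  refine ⟨h2.integral_prod_right, ?_⟩
  rw [← integral_map hg.aemeasurable (f := f) hf.aestronglyMeasurable, hmap,
    integral_withDensity_eq_integral_smul hd]
  simp only [hcoe]
  exact integral_prod_symm _ h2

theorem integrable_comp_add_iff (hθ : θ ≠ 0) {f : ℝ → ℝ} (hf : Measurable f) :
    Integrable (fun p : ℝ × ℝ => f (p.1 + p.2)) (μ.prod (gaussianReal 0 θ)) ↔
      Integrable (fun y => f y * outDensity μ θ y) (gaussianReal 0 θ) := by
  have hd : Measurable fun y : ℝ => (outDensity μ θ y).toNNReal := by fun_prop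
  have hmap : (μ.prod (gaussianReal 0 θ)).map (fun p => p.1 + p.2) =
      (gaussianReal 0 θ).withDensity
        (fun y => ((outDensity μ θ y).toNNReal : ℝ≥0∞)) := map_add_eq_withDensity hθ
  have hcoe : ∀ y, (outDensity μ θ y).toNNReal • f y = f y * outDensity μ θ y :=
    fun p => by
      rw [NNReal.smul_def, smul_eq_mul, Real.coe_toNNReal _ (outDensity_pos _ _ _).le, mul_comm]
  rw [← Function.comp_def f, ← integrable_map_measure hf.aestronglyMeasurable (by fun_prop), hmap,
    integrable_withDensity_iff_integrable_smul hd]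
  simp only [hcoe]

theorem integral_comp_add (hθ : θ ≠ 0) {f : ℝ → ℝ} (hf : Measurable f) :
    ∫ p : ℝ × ℝ, f (p.1 + p.2) ∂μ.prod (gaussianReal 0 θ) =
      ∫ y, f y * outDensity μ θ y ∂gaussianReal 0 θ := by
  have hd : Measurable fun y : ℝ => (outDensity μ θ y).toNNReal := by fun_prop
  have hmap : (μ.prod (gaussianReal 0 θ)).map (fun p => p.1 + p.2) =
      (gaussianReal 0 θ).withDensity
        (fun y => ((outDensity μ θ y).toNNReal : ℝ≥0∞)) := map_add_eq_withDensity hθ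
  have hcoe : ∀ y, (outDensity μ θ y).toNNReal • f y = f y * outDensity μ θ y :=
    fun p => by
      rw [NNReal.smul_def, smul_eq_mul, Real.coe_toNNReal _ (outDensity_pos _ _ _).le, mul_comm]
  rw [← integral_map (φ := fun p : ℝ × ℝ => p.1 + p.2) (by fun_prop) hf.aestronglyMeasurable, hmap,
    integral_withDensity_eq_integral_smul hd]
  simp only [hcoe]

/-- The unnormalized posterior mean of `X` given `X + N = y`. -/
def outMoment (μ : Measure ℝ) (θ : ℝ≥0) (y : ℝ) : ℝ := ∫ x, x * gaussKer θ x y ∂μ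

@[fun_prop]
theorem measurable_outMoment (μ : Measure ℝ) [IsProbabilityMeasure μ] (θ : ℝ≥0) :
    Measurable (outMoment μ θ) := by
  have h : StronglyMeasurable fun p : ℝ × ℝ => p.2 * gaussKer θ p.2 p.1 := by
    unfold gaussKer; exact Measurable.stronglyMeasurable (by fun_prop)
  exact h.integral_prod_right.measurable

theorem condExp_fst_comap_add (hθ : θ ≠ 0) (hm : MemLp id 2 μ) :
    (μ.prod (gaussianReal 0 θ))[Prod.fst |
        MeasurableSpace.comap (fun p : ℝ × ℝ => p.1 + p.2) inferInstance] =ᵐ[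
        μ.prod (gaussianReal 0 θ)]
      fun p => outMoment μ θ (p.1 + p.2) / outDensity μ θ (p.1 + p.2) := by
  have hY : Measurable fun p : ℝ × ℝ => p.1 + p.2 := by fun_prop
  have i1 : Integrable (fun x => x) μ := hm.integrable (by norm_num)
  have i1' : Integrable (Prod.fst : ℝ × ℝ → ℝ) (μ.prod (gaussianReal 0 θ)) := i1.comp_fst _
  set M : ℝ → ℝ := fun y => outMoment μ θ y / outDensity μ θ y
  have hM : Measurable M := by fun_prop
  have hMB : ∀ y, M y * outDensity μ θ y = outMoment μ θ y := fun y =>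
    div_mul_cancel₀ _ (outDensity_pos μ θ y).ne'
  have hMint : Integrable (fun p : ℝ × ℝ => M (p.1 + p.2)) (μ.prod (gaussianReal 0 θ)) := by
    rw [integrable_comp_add_iff hθ hM]
    simp only [hMB]
    exact (integral_comp_fst_add hθ (f := Prod.fst) measurable_fst i1').1
  refine (ae_eq_condExp_of_forall_setIntegral_eq hY.comap_le i1'
    (fun s _ _ => hMint.integrableOn) ?_ ?_).symm
  · rintro s ⟨S, hS, rfl⟩ -
    rw [← integral_indicator (hY hS), ← integral_indicator (hY hS)]
    have e1 := integral_comp_add (μ := μ) hθ (hM.indicator hS)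
    have hf2 : Measurable fun p : ℝ × ℝ => S.indicator (1 : ℝ → ℝ) p.2 * p.1 :=
      ((measurable_one.indicator hS).comp measurable_snd).mul measurable_fst
    have hind : ∀ p : ℝ × ℝ, S.indicator (1 : ℝ → ℝ) (p.1 + p.2) * p.1 =
        ((fun p : ℝ × ℝ => p.1 + p.2) ⁻¹' S).indicator Prod.fst p := fun p => by
      by_cases h : p.1 + p.2 ∈ S <;> simp [Set.indicator, h]
    have e2 := (integral_comp_fst_add (μ := μ) hθ hf2
      ((i1'.indicator (hY hS)).congr (ae_of_all _ fun p => (hind p).symm))).2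
    simp only [hind] at e2
    rw [e2]
    refine Eq.trans (Eq.trans ?_ e1) ?_
    · rfl
    · refine integral_congr_ae (ae_of_all _ fun y => ?_)
      simp only [mul_assoc]
      rw [integral_const_mul]
      by_cases h : y ∈ S
      · simp only [Set.indicator, h, if_true, hMB, Pi.one_apply, one_mul]; rfl
      · simp [Set.indicator, h]
  · exact (hM.stronglyMeasurable.comp_measurable
      (comap_measurable fun p : ℝ × ℝ => p.1 + p.2)).aestronglyMeasurable

/-- The second moment of the posterior mean `E[X | X + N]`. -/
def outGain (μ : Measure ℝ) (θ : ℝ≥0) : ℝ :=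
  ∫ y, outMoment μ θ y ^ 2 / outDensity μ θ y ∂gaussianReal 0 θ

theorem integral_sq_condExp_fst (hθ : θ ≠ 0) :
    ∫ p : ℝ × ℝ, (outMoment μ θ (p.1 + p.2) / outDensity μ θ (p.1 + p.2)) ^ 2
      ∂μ.prod (gaussianReal 0 θ) = outGain μ θ := by
  have h := integral_comp_add (μ := μ) hθ
    (f := fun y => (outMoment μ θ y / outDensity μ θ y) ^ 2) (by fun_prop)
  rw [h, outGain]
  refine integral_congr_ae (ae_of_all _ fun y => ?_)
  have := (outDensity_pos μ θ y).ne'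
  simp only
  field_simp

theorem minMSE_add_eq (hθ : θ ≠ 0) (hm : MemLp id 2 μ) (h0 : ∫ x, x ∂μ = 0) :
    minMSE (μ.prod (gaussianReal 0 θ)) Prod.fst (fun p => p.1 + p.2) =
      (∫ x, x ^ 2 ∂μ) - outGain μ θ := by
  have hY : Measurable fun p : ℝ × ℝ => p.1 + p.2 := by fun_prop
  have hX : MemLp (Prod.fst : ℝ × ℝ → ℝ) 2 (μ.prod (gaussianReal 0 θ)) := hm.comp_fst _
  have hmean : ∫ p : ℝ × ℝ, p.1 ∂μ.prod (gaussianReal 0 θ) = 0 := by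
    rw [integral_fun_fst (fun x : ℝ => x), h0]; simp
  have v1 : Var[Prod.fst; μ.prod (gaussianReal 0 θ)] = ∫ x, x ^ 2 ∂μ := by
    rw [variance_of_integral_eq_zero measurable_fst.aemeasurable hmean,
      integral_fun_fst (fun x : ℝ => x ^ 2)]
    simp
  rw [minMSE_eq_variance_sub hX hY, v1, variance_of_integral_eq_zero
    (hX.condExp one_le_two).aestronglyMeasurable.aemeasurable
    ((integral_condExp hY.comap_le).trans hmean), ← integral_sq_condExp_fst hθ]
  congr 1
  refine integral_congr_ae ?_
  filter_upwards [condExp_fst_comap_add hθ hm] with p hp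
  rw [hp]

theorem sq_le_outGain_mul (hθ : θ ≠ 0) (hm : MemLp id 2 μ) (h0 : ∫ x, x ∂μ = 0)
    (hv : 0 < ∫ x, x ^ 2 ∂μ) :
    (∫ x, x ^ 2 ∂μ) ^ 2 ≤ outGain μ θ * ((∫ x, x ^ 2 ∂μ) + θ) := by
  set v := ∫ x, x ^ 2 ∂μ
  set P := μ.prod (gaussianReal 0 θ)
  have hγ : MemLp (fun x : ℝ => x) 2 (gaussianReal 0 θ) := memLp_id_gaussianReal 2
  have hX : MemLp (fun p : ℝ × ℝ => p.1) 2 P := hm.comp_fst _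
  have hN : MemLp (fun p : ℝ × ℝ => p.2) 2 P := hγ.comp_snd _
  have hYL : MemLp (fun p : ℝ × ℝ => p.1 + p.2) 2 P := hX.add hN
  set M : ℝ → ℝ := fun y => outMoment μ θ y / outDensity μ θ y
  have hM : Measurable M := by fun_prop
  have hML : MemLp (fun p : ℝ × ℝ => M (p.1 + p.2)) 2 P :=
    (memLp_congr_ae (condExp_fst_comap_add hθ hm)).1 (MemLp.condExp one_le_two (hm.comp_fst _))
  have i1 : Integrable (fun x => x) μ := hm.integrable (by norm_num)
  have j1 : Integrable (fun x => x) (gaussianReal 0 θ) :=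
    (memLp_id_gaussianReal 1).integrable (by simp)
  have k2 : Integrable (fun p : ℝ × ℝ => p.1 * p.2) P := i1.mul_prod j1
  have hXY : ∫ p : ℝ × ℝ, p.1 * (p.1 + p.2) ∂P = v := by
    have : ∀ p : ℝ × ℝ, p.1 * (p.1 + p.2) = p.1 ^ 2 + p.1 * p.2 := fun p => by ring
    simp only [this]
    rw [integral_add hX.integrable_sq k2, integral_prod_mul (fun x => x) fun x => x, h0,
      integral_fun_fst (fun x : ℝ => x ^ 2)]
    simp [v]
  have hN2 : ∫ x : ℝ, x ^ 2 ∂gaussianReal 0 θ = θ := by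
    have := variance_fun_id_gaussianReal (μ := 0) (v := θ)
    rw [variance_of_integral_eq_zero (by fun_prop) (by simp)] at this
    exact this
  have hYY : ∫ p : ℝ × ℝ, (p.1 + p.2) ^ 2 ∂P = v + θ := by
    have : ∀ p : ℝ × ℝ, (p.1 + p.2) ^ 2 = p.1 ^ 2 + 2 * (p.1 * p.2) + p.2 ^ 2 := fun p => by ring
    simp only [this]
    have i12 : Integrable (fun p : ℝ × ℝ => p.1 ^ 2 + 2 * (p.1 * p.2)) P :=
      hX.integrable_sq.add (k2.const_mul 2)
    rw [integral_add i12 hN.integrable_sq,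
      integral_add hX.integrable_sq (k2.const_mul 2), integral_const_mul,
      integral_prod_mul (fun x => x) fun x => x, h0,
      integral_fun_fst (fun x : ℝ => x ^ 2), integral_fun_snd (fun x : ℝ => x ^ 2), hN2]
    simp [v]
  have hMY : ∫ p : ℝ × ℝ, M (p.1 + p.2) * (p.1 + p.2) ∂P = v := by
    have e1 := integral_comp_add (μ := μ) hθ (f := fun y => M y * y) (by fun_prop)
    have e2 := (integral_comp_fst_add (μ := μ) hθ (f := fun p => p.1 * p.2) (by fun_prop)
      (hX.integrable_mul hYL)).2
    rw [e1, ← hXY, e2]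
    refine integral_congr_ae (ae_of_all _ fun y => ?_)
    have hB := (outDensity_pos μ θ y).ne'
    have : ∀ x, x * y * gaussKer θ x y = y * (x * gaussKer θ x y) := fun x => by ring
    simp only [this]
    rw [integral_const_mul]
    simp only [M]
    field_simp
    exact mul_comm _ _
  set c := v / (v + θ)
  have hnn : 0 ≤ ∫ p : ℝ × ℝ, (M (p.1 + p.2) - c * (p.1 + p.2)) ^ 2 ∂P :=
    integral_nonneg fun p => sq_nonneg _
  have hexp : ∀ p : ℝ × ℝ, (M (p.1 + p.2) - c * (p.1 + p.2)) ^ 2 =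
      M (p.1 + p.2) ^ 2 - 2 * c * (M (p.1 + p.2) * (p.1 + p.2)) + c ^ 2 * (p.1 + p.2) ^ 2 :=
    fun p => by ring
  simp only [hexp] at hnn
  have iMY : Integrable (fun p : ℝ × ℝ => M (p.1 + p.2) * (p.1 + p.2)) P := hML.integrable_mul hYL
  have i12 : Integrable (fun p : ℝ × ℝ =>
      M (p.1 + p.2) ^ 2 - 2 * c * (M (p.1 + p.2) * (p.1 + p.2))) P :=
    hML.integrable_sq.sub (iMY.const_mul _)
  rw [integral_add i12 (hYL.integrable_sq.const_mul _),
    integral_sub hML.integrable_sq (iMY.const_mul _), integral_const_mul, integral_const_mul,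
    hMY, hYY, integral_sq_condExp_fst hθ] at hnn
  have hpos : 0 < v + θ := by have := θ.2; positivity
  have hc : c * (v + θ) = v := div_mul_cancel₀ _ hpos.ne'
  nlinarith [mul_nonneg hnn hpos.le]

end PosteriorMean

theorem sq_integral_mul_le {α : Type*} [MeasurableSpace α] {μ : Measure α} {g h : α → ℝ}
    (hh : ∀ a, 0 ≤ h a) (i0 : Integrable h μ) (i1 : Integrable (fun a => g a * h a) μ)
    (i2 : Integrable (fun a => g a ^ 2 * h a) μ) :
    (∫ a, g a * h a ∂μ) ^ 2 ≤ (∫ a, g a ^ 2 * h a ∂μ) * ∫ a, h a ∂μ := by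
  have key : ∀ c : ℝ, 0 ≤ (∫ a, h a ∂μ) * (c * c) + (-2 * ∫ a, g a * h a ∂μ) * c +
      ∫ a, g a ^ 2 * h a ∂μ := fun c => by
    have hnn : 0 ≤ ∫ a, (g a ^ 2 * h a - 2 * c * (g a * h a) + c ^ 2 * h a) ∂μ :=
      integral_nonneg fun a => by
        have := mul_nonneg (sq_nonneg (g a - c)) (hh a)
        simp only [Pi.zero_apply]
        nlinarith
    have i12 : Integrable (fun a => g a ^ 2 * h a - 2 * c * (g a * h a)) μ :=
      i2.sub (i1.const_mul _)
    rw [integral_add i12 (i0.const_mul _), integral_sub i2 (i1.const_mul _),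
      integral_const_mul, integral_const_mul] at hnn
    linarith
  have := discrim_le_zero key
  rw [discrim] at this
  linarith

/-- The density `gaussKer` in the normalization with unit noise variance. -/
def tiltKer (s z x : ℝ) : ℝ := Real.exp (s * z * x - s ^ 2 * x ^ 2 / 2)

theorem tiltKer_pos (s z x : ℝ) : 0 < tiltKer s z x := Real.exp_pos _

theorem tiltKer_le (s z x : ℝ) : tiltKer s z x ≤ Real.exp (z ^ 2 / 2) :=
  Real.exp_le_exp.2 (by nlinarith [sq_nonneg (z - s * x)])

@[fun_prop]
theorem measurable_tiltKer {α : Type*} [MeasurableSpace α] {f g h : α → ℝ} (hf : Measurable f)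
    (hg : Measurable g) (hh : Measurable h) : Measurable fun a => tiltKer (f a) (g a) (h a) := by
  unfold tiltKer; fun_prop

/-- A dominating function that is integrable under the standard Gaussian. -/
def tailBound (z : ℝ) : ℝ := Real.exp (z ^ 2 / 2) / (1 + z ^ 2)

theorem tailBound_pos (z : ℝ) : 0 < tailBound z := by unfold tailBound; positivity

theorem integrable_tailBound : Integrable tailBound (gaussianReal 0 1) := by
  have hpdf : Measurable fun x => (gaussianPDFReal 0 1 x).toNNReal := by fun_prop
  have h : gaussianReal 0 1 =
      volume.withDensity fun x => ((gaussianPDFReal 0 1 x).toNNReal : ℝ≥0∞) :=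
    gaussianReal_of_var_ne_zero 0 one_ne_zero
  rw [h, integrable_withDensity_iff_integrable_smul hpdf]
  refine (integrable_inv_one_add_sq.const_mul (√(2 * Real.pi))⁻¹).congr (ae_of_all _ fun x => ?_)
  have he : Real.exp (-(x - 0) ^ 2 / (2 * (1 : ℝ≥0))) * Real.exp (x ^ 2 / 2) = 1 := by
    rw [← Real.exp_add]; simp [neg_div]
  simp only [NNReal.smul_def, smul_eq_mul, tailBound]
  rw [Real.coe_toNNReal _ (gaussianPDFReal_nonneg 0 1 x), gaussianPDFReal, mul_assoc (√_)⁻¹,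
    mul_div_assoc', he]
  simp

theorem one_add_sq_mul_tiltKer_le {s : ℝ} (hs : |s| ≤ 1) (z x : ℝ) :
    (1 + z ^ 2) * tiltKer s z x ≤ 32 * (1 + x ^ 2) ^ 2 * tailBound z := by
  have hs2 : s ^ 2 ≤ 1 := by rwa [sq_le_one_iff_abs_le_one]
  set w := z - s * x with hw
  have h1 : tiltKer s z x = Real.exp (z ^ 2 / 2) * Real.exp (-(w ^ 2 / 2)) := by
    rw [tiltKer, ← Real.exp_add]; congr 1; rw [hw]; ring
  have hx : s ^ 2 * x ^ 2 ≤ x ^ 2 := by nlinarith [sq_nonneg x]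
  have h2 : 1 + z ^ 2 ≤ 2 * (1 + w ^ 2) * (1 + x ^ 2) := by
    have : z = w + s * x := by rw [hw]; ring
    rw [this]
    nlinarith [sq_nonneg (w - s * x), mul_nonneg (sq_nonneg w) (sq_nonneg x)]
  have h3 : (1 + w ^ 2) ^ 2 ≤ 8 * Real.exp (w ^ 2 / 2) := by
    have := Real.quadratic_le_exp_of_nonneg (x := w ^ 2 / 2) (by positivity)
    nlinarith
  have h4 : (1 + z ^ 2) ^ 2 ≤ 32 * (1 + x ^ 2) ^ 2 * Real.exp (w ^ 2 / 2) := by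
    calc (1 + z ^ 2) ^ 2 ≤ (2 * (1 + w ^ 2) * (1 + x ^ 2)) ^ 2 :=
          pow_le_pow_left₀ (by positivity) h2 2
      _ = 4 * (1 + x ^ 2) ^ 2 * (1 + w ^ 2) ^ 2 := by ring
      _ ≤ 4 * (1 + x ^ 2) ^ 2 * (8 * Real.exp (w ^ 2 / 2)) := by gcongr
      _ = _ := by ring
  rw [h1, tailBound, mul_div_assoc', le_div_iff₀ (by positivity)]
  calc (1 + z ^ 2) * (Real.exp (z ^ 2 / 2) * Real.exp (-(w ^ 2 / 2))) * (1 + z ^ 2)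
      = Real.exp (z ^ 2 / 2) * Real.exp (-(w ^ 2 / 2)) * (1 + z ^ 2) ^ 2 := by ring
    _ ≤ Real.exp (z ^ 2 / 2) * Real.exp (-(w ^ 2 / 2)) *
        (32 * (1 + x ^ 2) ^ 2 * Real.exp (w ^ 2 / 2)) := by gcongr
    _ = 32 * (1 + x ^ 2) ^ 2 * Real.exp (z ^ 2 / 2) *
        (Real.exp (-(w ^ 2 / 2)) * Real.exp (w ^ 2 / 2)) := by ring
    _ = _ := by rw [← Real.exp_add]; simp

theorem one_add_sq_mul_one_add_tiltKer_le {s : ℝ} (hs : |s| ≤ 1) (z x : ℝ) :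
    (1 + z ^ 2) * (1 + tiltKer s z x) ≤ 64 * (1 + x ^ 2) ^ 2 * tailBound z := by
  have h0 := one_add_sq_mul_tiltKer_le (s := 0) (by simp) z x
  have h1 := one_add_sq_mul_tiltKer_le hs z x
  have : tiltKer 0 z x = 1 := by simp [tiltKer]
  rw [this] at h0
  linarith

theorem abs_exp_sub_one_le (u : ℝ) : |Real.exp u - 1| ≤ |u| * (1 + Real.exp u) := by
  have h1 := Real.add_one_le_exp u
  have h2 := Real.add_one_le_exp (-u)
  have h3 : Real.exp u * Real.exp (-u) = 1 := by rw [← Real.exp_add]; simp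
  have h4 := Real.exp_pos u
  rcases le_total 0 u with h | h
  · rw [abs_of_nonneg h, abs_of_nonneg (by linarith)]
    nlinarith
  · rw [abs_of_nonpos h, abs_of_nonpos (by linarith [Real.exp_le_one_iff.2 h])]
    nlinarith

theorem klFun_exp_le (u : ℝ) : klFun (Real.exp u) ≤ u ^ 2 * (1 + Real.exp u) := by
  have h1 := Real.add_one_le_exp u
  have h2 := abs_exp_sub_one_le u
  have h3 : u * (Real.exp u - 1) ≤ |u| * |Real.exp u - 1| := by
    rw [← abs_mul]; exact le_abs_self _
  have h4 := mul_le_mul_of_nonneg_left h2 (abs_nonneg u)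
  have h5 : |u| * (|u| * (1 + Real.exp u)) = u ^ 2 * (1 + Real.exp u) := by
    rw [← mul_assoc, ← sq, sq_abs]
  rw [klFun_apply, Real.log_exp]
  linarith

theorem klFun_le_sq {t : ℝ} (ht : 0 < t) : klFun t ≤ (t - 1) ^ 2 := by
  have := Real.log_le_sub_one_of_pos ht
  rw [klFun_apply]
  nlinarith

theorem sq_exponent_le {s : ℝ} (hs : |s| ≤ 1) (z x : ℝ) :
    (s * z * x - s ^ 2 * x ^ 2 / 2) ^ 2 ≤ 2 * s ^ 2 * (1 + z ^ 2) * (1 + x ^ 2) ^ 2 := by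
  have hs2 : s ^ 2 ≤ 1 := by rwa [sq_le_one_iff_abs_le_one]
  have h1 : (z * x - s * x ^ 2 / 2) ^ 2 ≤ 2 * (1 + z ^ 2) * (1 + x ^ 2) ^ 2 := by
    have h2 : (z * x - s * x ^ 2 / 2) ^ 2 ≤ 2 * (z * x) ^ 2 + 2 * (s * x ^ 2 / 2) ^ 2 := by
      nlinarith [sq_nonneg (z * x + s * x ^ 2 / 2)]
    have h3 : (s * x ^ 2 / 2) ^ 2 ≤ x ^ 4 := by nlinarith [sq_nonneg (x ^ 2)]
    have h4 : 0 ≤ z ^ 2 * x ^ 4 := by positivity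
    nlinarith [sq_nonneg x, sq_nonneg z, mul_nonneg (sq_nonneg z) (sq_nonneg x)]
  calc (s * z * x - s ^ 2 * x ^ 2 / 2) ^ 2 = s ^ 2 * (z * x - s * x ^ 2 / 2) ^ 2 := by ring
    _ ≤ s ^ 2 * (2 * (1 + z ^ 2) * (1 + x ^ 2) ^ 2) := by gcongr
    _ = _ := by ring

theorem sq_exponent_mul_le {s : ℝ} (hs : |s| ≤ 1) (z x : ℝ) :
    (s * z * x - s ^ 2 * x ^ 2 / 2) ^ 2 * (1 + tiltKer s z x) ≤
      s ^ 2 * (128 * tailBound z * (1 + x ^ 2) ^ 4) := by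
  have h1 := sq_exponent_le hs z x
  have h2 := one_add_sq_mul_one_add_tiltKer_le hs z x
  have h3 := tiltKer_pos s z x
  calc (s * z * x - s ^ 2 * x ^ 2 / 2) ^ 2 * (1 + tiltKer s z x)
      ≤ 2 * s ^ 2 * (1 + z ^ 2) * (1 + x ^ 2) ^ 2 * (1 + tiltKer s z x) := by gcongr
    _ = 2 * s ^ 2 * (1 + x ^ 2) ^ 2 * ((1 + z ^ 2) * (1 + tiltKer s z x)) := by ring
    _ ≤ 2 * s ^ 2 * (1 + x ^ 2) ^ 2 * (64 * (1 + x ^ 2) ^ 2 * tailBound z) := by gcongr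
    _ = _ := by ring

/-- Normalized form of `outDensity`. -/
def tiltMass (μ : Measure ℝ) (s z : ℝ) : ℝ := ∫ x, tiltKer s z x ∂μ

/-- Normalized form of `outMoment`. -/
def tiltMoment (μ : Measure ℝ) (s z : ℝ) : ℝ := ∫ x, x * tiltKer s z x ∂μ

/-- Normalized form of `outGain`. -/
def tiltGain (μ : Measure ℝ) (s : ℝ) : ℝ :=
  ∫ z, tiltMoment μ s z ^ 2 / tiltMass μ s z ∂gaussianReal 0 1

/-- Divergence of the output law from the noise law in the normalization with unit noise. -/
def tiltKL (μ : Measure ℝ) (s : ℝ) : ℝ := ∫ z, klFun (tiltMass μ s z) ∂gaussianReal 0 1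

theorem gaussKer_sqrt_mul {θ : ℝ≥0} (hθ : θ ≠ 0) (x z : ℝ) :
    gaussKer θ x (√θ * z) = tiltKer (√θ)⁻¹ z x := by
  have hθ' : (0 : ℝ) < θ := by exact_mod_cast pos_iff_ne_zero.2 hθ
  have hs : (0 : ℝ) < √θ := Real.sqrt_pos.2 hθ'
  rw [gaussKer, tiltKer]
  congr 1
  nth_rw 2 [← Real.sq_sqrt hθ'.le]
  field_simp

theorem integral_gaussianReal_eq_scale {θ : ℝ≥0} {f : ℝ → ℝ} (hf : Measurable f) :
    ∫ y, f y ∂gaussianReal 0 θ = ∫ z, f (√θ * z) ∂gaussianReal 0 1 := by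
  have h := gaussianReal_map_const_mul (μ := 0) (v := 1) (√(θ : ℝ))
  have hv : NNReal.mk (√(θ : ℝ) ^ 2) (sq_nonneg _) * 1 = θ := by
    ext; simp [Real.sq_sqrt]
  rw [hv, mul_zero] at h
  rw [← h, integral_map (by fun_prop) hf.aestronglyMeasurable]

theorem integrable_pow_of_even_moments {μ : Measure ℝ}
    (hmom : ∀ n : ℕ, Integrable (fun x => (1 + x ^ 2) ^ n) μ) (k : ℕ) :
    Integrable (fun x => x ^ k) μ := by
  refine (hmom k).mono (by fun_prop) (ae_of_all _ fun x => ?_)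
  rw [norm_pow, Real.norm_eq_abs, Real.norm_of_nonneg (by positivity)]
  refine pow_le_pow_left₀ (abs_nonneg x) ?_ k
  nlinarith [sq_abs x, sq_nonneg (|x| - 1), abs_nonneg x]

section Small

variable {μ : Measure ℝ} [IsProbabilityMeasure μ]

theorem outGain_eq_tiltGain {θ : ℝ≥0} (hθ : θ ≠ 0) : outGain μ θ = tiltGain μ (√θ)⁻¹ := by
  rw [outGain, integral_gaussianReal_eq_scale (by fun_prop)]
  simp only [outMoment, outDensity, gaussKer_sqrt_mul hθ]
  rfl

theorem integral_klFun_outDensity {θ : ℝ≥0} (hθ : θ ≠ 0) :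
    ∫ y, klFun (outDensity μ θ y) ∂gaussianReal 0 θ = tiltKL μ (√θ)⁻¹ := by
  rw [integral_gaussianReal_eq_scale (by fun_prop)]
  simp only [outDensity, gaussKer_sqrt_mul hθ]
  rfl

theorem integrable_tiltKer (s z : ℝ) : Integrable (tiltKer s z) μ :=
  Integrable.of_bound (by unfold tiltKer; fun_prop) (Real.exp (z ^ 2 / 2))
    (ae_of_all _ fun x => by
      rw [Real.norm_of_nonneg (tiltKer_pos s z x).le]; exact tiltKer_le s z x)

theorem integrable_mul_tiltKer {f : ℝ → ℝ} (hf : Integrable f μ) (s z : ℝ) :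
    Integrable (fun x => f x * tiltKer s z x) μ :=
  hf.mul_bdd (c := Real.exp (z ^ 2 / 2)) (integrable_tiltKer s z).aestronglyMeasurable
    (ae_of_all _ fun x => by
      rw [Real.norm_of_nonneg (tiltKer_pos s z x).le]; exact tiltKer_le s z x)

theorem tiltMass_pos (μ : Measure ℝ) [IsProbabilityMeasure μ] (s z : ℝ) : 0 < tiltMass μ s z := by
  refine (integral_pos_iff_support_of_nonneg (fun x => (tiltKer_pos s z x).le)
    (integrable_tiltKer s z)).2 ?_
  have : Function.support (fun x => tiltKer s z x) = Set.univ := by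
    ext x; simpa using (tiltKer_pos s z x).ne'
  simp [this]

@[fun_prop]
theorem measurable_tiltMass (s : ℝ) : Measurable (tiltMass μ s) := by
  have h : StronglyMeasurable fun p : ℝ × ℝ => tiltKer s p.1 p.2 :=
    Measurable.stronglyMeasurable (by fun_prop)
  exact h.integral_prod_right.measurable

@[fun_prop]
theorem measurable_tiltMoment (s : ℝ) : Measurable (tiltMoment μ s) := by
  have h : StronglyMeasurable fun p : ℝ × ℝ => p.2 * tiltKer s p.1 p.2 :=
    Measurable.stronglyMeasurable (by fun_prop)
  exact h.integral_prod_right.measurable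

theorem continuous_integral_mul_tiltKer {f : ℝ → ℝ} (hf : Integrable f μ) (z : ℝ) :
    Continuous fun s => ∫ x, f x * tiltKer s z x ∂μ := by
  refine continuous_of_dominated (bound := fun x => |f x| * Real.exp (z ^ 2 / 2))
    (fun s => (integrable_mul_tiltKer hf s z).aestronglyMeasurable)
    (fun s => ae_of_all _ fun x => ?_) (hf.abs.mul_const _) (ae_of_all _ fun x => ?_)
  · rw [norm_mul, Real.norm_eq_abs, Real.norm_of_nonneg (tiltKer_pos s z x).le]
    exact mul_le_mul_of_nonneg_left (tiltKer_le s z x) (abs_nonneg _)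
  · unfold tiltKer; fun_prop

theorem continuous_tiltMass (z : ℝ) : Continuous fun s => tiltMass μ s z := by
  simpa [tiltMass] using continuous_integral_mul_tiltKer (μ := μ) (integrable_const (1 : ℝ)) z

theorem integral_mul_tiltKer_sub_one {f : ℝ → ℝ} (hf : Integrable f μ) (s z : ℝ) :
    ∫ x, f x * (tiltKer s z x - 1) ∂μ = (∫ x, f x * tiltKer s z x ∂μ) - ∫ x, f x ∂μ := by
  simp only [mul_sub, mul_one]
  exact integral_sub (integrable_mul_tiltKer hf s z) hf

/-- First-order expansion of `E[f(X) exp(szX - s²X²/2)]` in `s`. -/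
theorem tendsto_integral_mul_tiltKer_sub {f : ℝ → ℝ} (hf : Integrable f μ)
    (hf2 : Integrable (fun x => f x * (1 + x ^ 2)) μ) (z : ℝ) :
    Tendsto (fun s => ((∫ x, f x * tiltKer s z x ∂μ) - ∫ x, f x ∂μ) / s) (𝓝[≠] 0)
      (𝓝 (z * ∫ x, f x * x ∂μ)) := by
  have h1 : ∀ s, ((∫ x, f x * tiltKer s z x ∂μ) - ∫ x, f x ∂μ) / s =
      ∫ x, f x * ((tiltKer s z x - 1) / s) ∂μ := fun s => by
    rw [← integral_mul_tiltKer_sub_one hf, ← integral_div]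
    simp only [mul_div_assoc]
  have h2 : z * ∫ x, f x * x ∂μ = ∫ x, f x * (z * x) ∂μ := by
    rw [← integral_const_mul]
    congr 1; ext x; ring
  simp only [h1, h2]
  set C := (|z| + 1) * (1 + Real.exp (z ^ 2 / 2))
  refine tendsto_integral_filter_of_dominated_convergence
    (fun x => C * |f x * (1 + x ^ 2)|) (.of_forall fun s => ?_) ?_
    (hf2.abs.const_mul C) (ae_of_all _ fun x => ?_)
  · exact hf.aestronglyMeasurable.mul
      (Measurable.aestronglyMeasurable (by fun_prop))
  · have : ∀ᶠ s : ℝ in 𝓝[≠] 0, |s| < 1 := by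
      refine nhdsWithin_le_nhds ?_
      have := Metric.ball_mem_nhds (0 : ℝ) one_pos
      filter_upwards [this] with s hs
      simpa using hs
    filter_upwards [this, self_mem_nhdsWithin] with s hs hs0
    refine ae_of_all _ fun x => ?_
    have hs0' : 0 < |s| := abs_pos.2 hs0
    have hu : |s * z * x - s ^ 2 * x ^ 2 / 2| ≤ |s| * ((|z| + 1) * (1 + x ^ 2)) := by
      have e : s * z * x - s ^ 2 * x ^ 2 / 2 = s * (z * x - s * x ^ 2 / 2) := by ring
      rw [e, abs_mul]
      refine mul_le_mul_of_nonneg_left ?_ (abs_nonneg s)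
      have a1 : |z * x - s * x ^ 2 / 2| ≤ |z| * |x| + |s| * x ^ 2 / 2 := by
        refine (abs_sub _ _).trans (le_of_eq ?_)
        rw [abs_mul, abs_div, abs_mul, abs_of_nonneg (sq_nonneg x)]
        norm_num
      have a2 : |x| ≤ 1 + x ^ 2 := by nlinarith [sq_abs x, sq_nonneg (|x| - 1), abs_nonneg x]
      have a3 := mul_le_mul_of_nonneg_left a2 (abs_nonneg z)
      have a4 := mul_le_mul_of_nonneg_right hs.le (sq_nonneg x)
      nlinarith [sq_nonneg x]
    have ht : |tiltKer s z x - 1| ≤ |s| * (C * (1 + x ^ 2)) := by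
      have b1 := abs_exp_sub_one_le (s * z * x - s ^ 2 * x ^ 2 / 2)
      have b2 := tiltKer_le s z x
      have b3 := tiltKer_pos s z x
      rw [← tiltKer] at b1
      calc |tiltKer s z x - 1| ≤ _ := b1
        _ ≤ |s| * ((|z| + 1) * (1 + x ^ 2)) * (1 + Real.exp (z ^ 2 / 2)) := by gcongr
        _ = _ := by simp only [C]; ring
    rw [norm_mul, Real.norm_eq_abs, Real.norm_eq_abs, abs_div, abs_mul,
      abs_of_nonneg (by positivity : 0 ≤ 1 + x ^ 2)]
    have : |tiltKer s z x - 1| / |s| ≤ C * (1 + x ^ 2) := by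
      rw [div_le_iff₀ hs0']; linarith
    calc |f x| * (|tiltKer s z x - 1| / |s|) ≤ |f x| * (C * (1 + x ^ 2)) := by gcongr
      _ = _ := by ring
  · refine Tendsto.const_mul _ ?_
    have hd : HasDerivAt (fun s => tiltKer s z x) (z * x) 0 := by
      have e : HasDerivAt (fun s : ℝ => s * z * x - s ^ 2 * x ^ 2 / 2) (z * x) 0 := by
        have := ((((hasDerivAt_id (0 : ℝ)).mul_const z).mul_const x).sub
          ((((hasDerivAt_id (0 : ℝ)).pow 2).mul_const (x ^ 2)).div_const 2))
        exact this.congr_deriv (by simp)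
      have := e.exp
      simpa [tiltKer] using this
    have := hd.tendsto_slope
    refine this.congr fun s => ?_
    simp [slope_def_field, tiltKer]

theorem one_sub_le_tiltMass (hmom : ∀ n : ℕ, Integrable (fun x => (1 + x ^ 2) ^ n) μ)
    (h0 : ∫ x, x ∂μ = 0) (s z : ℝ) :
    1 - s ^ 2 * (∫ x, x ^ 2 ∂μ) / 2 ≤ tiltMass μ s z := by
  have i2 : Integrable (fun x => x ^ 2) μ := integrable_pow_of_even_moments hmom 2
  have i1 : Integrable (fun x => x) μ := by simpa using integrable_pow_of_even_moments hmom 1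
  have i3 : Integrable (fun x => s * z * x - s ^ 2 * x ^ 2 / 2) μ :=
    (i1.const_mul (s * z)).sub ((i2.const_mul (s ^ 2)).div_const 2)
  have h : ∫ x, (s * z * x - s ^ 2 * x ^ 2 / 2 + 1) ∂μ ≤ tiltMass μ s z :=
    integral_mono (i3.add (integrable_const 1)) (integrable_tiltKer s z)
      fun x => Real.add_one_le_exp _
  rw [integral_add i3 (integrable_const 1), integral_sub (i1.const_mul (s * z))
    ((i2.const_mul (s ^ 2)).div_const 2), integral_const_mul, integral_div, integral_const_mul,
    h0] at h
  simp at h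
  linarith

end Small

theorem integrable_of_abs_le_even_moment {μ : Measure ℝ}
    (hmom : ∀ n : ℕ, Integrable (fun x => (1 + x ^ 2) ^ n) μ)
    {f : ℝ → ℝ} (hf : Measurable f) (n : ℕ) {C : ℝ} (hC : ∀ x, |f x| ≤ C * (1 + x ^ 2) ^ n) :
    Integrable f μ :=
  ((hmom n).const_mul C).mono' hf.aestronglyMeasurable (ae_of_all _ hC)

theorem integrable_sq_exponent_mul {μ : Measure ℝ}
    (hmom : ∀ n : ℕ, Integrable (fun x => (1 + x ^ 2) ^ n) μ)
    {s : ℝ} (hs : |s| ≤ 1) (z : ℝ) :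
    Integrable (fun x => (s * z * x - s ^ 2 * x ^ 2 / 2) ^ 2 * (1 + tiltKer s z x)) μ := by
  refine integrable_of_abs_le_even_moment hmom (by fun_prop) 4 (C := s ^ 2 * (128 * tailBound z))
    fun x => ?_
  have := tiltKer_pos s z x
  rw [abs_of_nonneg (by positivity)]
  have := sq_exponent_mul_le hs z x
  linarith

section SmallSignal

variable {μ : Measure ℝ} [IsProbabilityMeasure μ]

theorem tiltMoment_sq_div_le (hmom : ∀ n : ℕ, Integrable (fun x => (1 + x ^ 2) ^ n) μ)
    {s : ℝ} (hs : |s| ≤ 1) (z : ℝ) :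
    tiltMoment μ s z ^ 2 / tiltMass μ s z ≤ (32 * ∫ x, (1 + x ^ 2) ^ 3 ∂μ) * tailBound z := by
  have i1 : Integrable (fun x => x) μ := by simpa using integrable_pow_of_even_moments hmom 1
  have i2 := integrable_pow_of_even_moments hmom 2
  have h := sq_integral_mul_le (fun x => (tiltKer_pos s z x).le) (integrable_tiltKer s z)
    (integrable_mul_tiltKer i1 s z) (integrable_mul_tiltKer i2 s z)
  rw [div_le_iff₀ (tiltMass_pos μ s z)]
  refine h.trans (mul_le_mul_of_nonneg_right ?_ (tiltMass_pos μ s z).le)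
  rw [← integral_const_mul, ← integral_mul_const]
  refine integral_mono (integrable_mul_tiltKer i2 s z) (((hmom 3).const_mul _).mul_const _)
    fun x => ?_
  have b := one_add_sq_mul_tiltKer_le hs z x
  have c := tiltKer_pos s z x
  calc x ^ 2 * tiltKer s z x ≤ (1 + x ^ 2) * ((1 + z ^ 2) * tiltKer s z x) := by
        have : x ^ 2 ≤ (1 + x ^ 2) * (1 + z ^ 2) := by
          nlinarith [mul_nonneg (sq_nonneg x) (sq_nonneg z)]
        rw [← mul_assoc]
        exact mul_le_mul_of_nonneg_right this c.le
    _ ≤ (1 + x ^ 2) * (32 * (1 + x ^ 2) ^ 2 * tailBound z) := by gcongr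
    _ = _ := by ring

theorem continuousOn_tiltGain (hmom : ∀ n : ℕ, Integrable (fun x => (1 + x ^ 2) ^ n) μ) :
    ContinuousOn (tiltGain μ) (Set.Icc 0 1) := by
  have i1 : Integrable (fun x => x) μ := by simpa using integrable_pow_of_even_moments hmom 1
  refine continuousOn_of_dominated
    (bound := fun z => (32 * ∫ x, (1 + x ^ 2) ^ 3 ∂μ) * tailBound z)
    (fun s _ => Measurable.aestronglyMeasurable (by fun_prop)) (fun s hs => ae_of_all _ fun z => ?_)
    (integrable_tailBound.const_mul _) (ae_of_all _ fun z => ?_)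
  · rw [Real.norm_of_nonneg (div_nonneg (sq_nonneg _) (tiltMass_pos μ s z).le)]
    exact tiltMoment_sq_div_le hmom (abs_le.2 ⟨by linarith [hs.1], hs.2⟩) z
  · exact Continuous.continuousOn <| ((continuous_integral_mul_tiltKer i1 z).pow 2).div
      (continuous_tiltMass z) fun s => (tiltMass_pos μ s z).ne'

theorem eventually_abs_le_one : ∀ᶠ s : ℝ in 𝓝[≠] 0, |s| ≤ 1 := by
  refine nhdsWithin_le_nhds ?_
  filter_upwards [Metric.ball_mem_nhds (0 : ℝ) one_pos] with s hs
  simpa using (mem_ball_zero_iff.1 hs).le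

theorem klFun_tiltMass_le (hmom : ∀ n : ℕ, Integrable (fun x => (1 + x ^ 2) ^ n) μ)
    {s : ℝ} (hs : |s| ≤ 1) (z : ℝ) :
    klFun (tiltMass μ s z) ≤ s ^ 2 * ((128 * ∫ x, (1 + x ^ 2) ^ 4 ∂μ) * tailBound z) := by
  have hint := integrable_sq_exponent_mul hmom hs z
  have hk : Integrable (fun x => klFun (tiltKer s z x)) μ := by
    refine hint.mono' (measurable_klFun.comp (by fun_prop)).aestronglyMeasurable
      (ae_of_all _ fun x => ?_)
    rw [Real.norm_of_nonneg (klFun_nonneg (tiltKer_pos s z x).le)]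
    exact klFun_exp_le _
  calc klFun (tiltMass μ s z) ≤ ∫ x, klFun (tiltKer s z x) ∂μ :=
        convexOn_klFun.map_integral_le continuous_klFun.continuousOn isClosed_Ici
          (ae_of_all _ fun x => (tiltKer_pos s z x).le) (integrable_tiltKer s z) hk
    _ ≤ ∫ x, s ^ 2 * (128 * tailBound z * (1 + x ^ 2) ^ 4) ∂μ :=
        integral_mono hk (((hmom 4).const_mul _).const_mul _) fun x =>
          (klFun_exp_le _).trans (sq_exponent_mul_le hs z x)
    _ = _ := by rw [integral_const_mul, integral_const_mul]; ring

theorem tendsto_tiltKL_div (hmom : ∀ n : ℕ, Integrable (fun x => (1 + x ^ 2) ^ n) μ)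
    (h0 : ∫ x, x ∂μ = 0) : Tendsto (fun s => tiltKL μ s / s ^ 2) (𝓝[≠] 0) (𝓝 0) := by
  have e : ∀ s, tiltKL μ s / s ^ 2 =
      ∫ z, klFun (tiltMass μ s z) / s ^ 2 ∂gaussianReal 0 1 := fun s => (integral_div _ _).symm
  simp only [e]
  suffices h : Tendsto (fun s => ∫ z, klFun (tiltMass μ s z) / s ^ 2 ∂gaussianReal 0 1) (𝓝[≠] 0)
      (𝓝 (∫ _, (0 : ℝ) ∂gaussianReal 0 1)) by rwa [integral_zero] at h
  refine tendsto_integral_filter_of_dominated_convergence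
    (fun z => (128 * ∫ x, (1 + x ^ 2) ^ 4 ∂μ) * tailBound z)
    (.of_forall fun s => Measurable.aestronglyMeasurable
      ((measurable_klFun.comp (measurable_tiltMass s)).div_const _)) ?_
    (integrable_tailBound.const_mul _) (ae_of_all _ fun z => ?_)
  · filter_upwards [eventually_abs_le_one, self_mem_nhdsWithin] with s hs hs0
    refine ae_of_all _ fun z => ?_
    have hs2 : 0 < s ^ 2 := by have : s ≠ 0 := hs0; positivity
    rw [Real.norm_of_nonneg (div_nonneg (klFun_nonneg (tiltMass_pos μ s z).le) hs2.le),
      div_le_iff₀ hs2]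
    linarith [klFun_tiltMass_le hmom hs z]
  · have h1 := tendsto_integral_mul_tiltKer_sub (μ := μ) (f := fun _ => 1) (integrable_const _)
      (by simpa using hmom 1) z
    simp only [one_mul, h0, mul_zero] at h1
    have h2 : Tendsto (fun s => ((tiltMass μ s z - 1) / s) ^ 2) (𝓝[≠] 0) (𝓝 0) := by
      have := h1.pow 2
      simpa [tiltMass] using this
    refine squeeze_zero (fun s => div_nonneg (klFun_nonneg (tiltMass_pos μ s z).le) (sq_nonneg s))
      (fun s => ?_) h2
    rw [div_pow]
    exact div_le_div_of_nonneg_right (klFun_le_sq (tiltMass_pos μ s z)) (sq_nonneg s)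

theorem tiltMoment_sq_div_le_sq_mul (hmom : ∀ n : ℕ, Integrable (fun x => (1 + x ^ 2) ^ n) μ)
    (h0 : ∫ x, x ∂μ = 0) {s : ℝ} (hs : |s| ≤ 1) (hsv : s ^ 2 * (∫ x, x ^ 2 ∂μ) ≤ 1) (z : ℝ) :
    tiltMoment μ s z ^ 2 / tiltMass μ s z ≤
      s ^ 2 * ((384 * ∫ x, (1 + x ^ 2) ^ 5 ∂μ) * tailBound z) := by
  have i1 : Integrable (fun x => x) μ := by simpa using integrable_pow_of_even_moments hmom 1
  have hB := one_sub_le_tiltMass hmom h0 s z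
  have hB0 := tiltMass_pos μ s z
  set u : ℝ → ℝ := fun x => s * z * x - s ^ 2 * x ^ 2 / 2 with hu
  have hum : Measurable u := by fun_prop
  have hk0 : ∀ x, 0 ≤ 1 + tiltKer s z x := fun x => by linarith [tiltKer_pos s z x]
  have j0 : Integrable (fun x => 1 + tiltKer s z x) μ :=
    (integrable_const 1).add (integrable_tiltKer s z)
  have bd : ∀ x, (|x| * |u x|) ^ 2 * (1 + tiltKer s z x) ≤
      s ^ 2 * (128 * tailBound z * (1 + x ^ 2) ^ 5) := fun x => by
    have h1 := sq_exponent_mul_le hs z x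
    have h2 : 0 ≤ s ^ 2 * (128 * tailBound z * (1 + x ^ 2) ^ 4) := by
      have := tailBound_pos z; positivity
    calc (|x| * |u x|) ^ 2 * (1 + tiltKer s z x)
        = x ^ 2 * (u x ^ 2 * (1 + tiltKer s z x)) := by rw [mul_pow, sq_abs, sq_abs]; ring
      _ ≤ x ^ 2 * (s ^ 2 * (128 * tailBound z * (1 + x ^ 2) ^ 4)) :=
          mul_le_mul_of_nonneg_left h1 (sq_nonneg x)
      _ ≤ (1 + x ^ 2) * (s ^ 2 * (128 * tailBound z * (1 + x ^ 2) ^ 4)) :=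
          mul_le_mul_of_nonneg_right (by linarith) h2
      _ = _ := by ring
  have j2 : Integrable (fun x => (|x| * |u x|) ^ 2 * (1 + tiltKer s z x)) μ := by
    refine integrable_of_abs_le_even_moment hmom (by fun_prop) 5 (C := s ^ 2 * (128 * tailBound z))
      fun x => ?_
    rw [abs_of_nonneg (mul_nonneg (sq_nonneg _) (hk0 x))]
    linarith [bd x]
  have j1 : Integrable (fun x => (|x| * |u x|) * (1 + tiltKer s z x)) μ := by
    refine (j0.add j2).mono' (Measurable.aestronglyMeasurable (by fun_prop))
      (ae_of_all _ fun x => ?_)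
    have hp : 0 ≤ |x| * |u x| := by positivity
    rw [Real.norm_of_nonneg (mul_nonneg hp (hk0 x))]
    have : |x| * |u x| ≤ 1 + (|x| * |u x|) ^ 2 := by nlinarith [sq_nonneg (|x| * |u x| - 1)]
    calc |x| * |u x| * (1 + tiltKer s z x)
        ≤ (1 + (|x| * |u x|) ^ 2) * (1 + tiltKer s z x) := mul_le_mul_of_nonneg_right this (hk0 x)
      _ = _ := by simp only [Pi.add_apply]; ring
  have hA : |tiltMoment μ s z| ≤ ∫ x, (|x| * |u x|) * (1 + tiltKer s z x) ∂μ := by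
    have e : tiltMoment μ s z = ∫ x, x * (tiltKer s z x - 1) ∂μ := by
      rw [integral_mul_tiltKer_sub_one i1, h0, sub_zero]; rfl
    rw [e, ← Real.norm_eq_abs]
    refine norm_integral_le_of_norm_le j1 (ae_of_all _ fun x => ?_)
    rw [norm_mul, Real.norm_eq_abs, Real.norm_eq_abs, mul_assoc]
    exact mul_le_mul_of_nonneg_left (abs_exp_sub_one_le _) (abs_nonneg x)
  have hCS := sq_integral_mul_le hk0 j0 j1 j2
  have hmass : ∫ x, (1 + tiltKer s z x) ∂μ = 1 + tiltMass μ s z := by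
    rw [integral_add (integrable_const 1) (integrable_tiltKer s z)]; simp [tiltMass]
  have hD : ∫ x, (|x| * |u x|) ^ 2 * (1 + tiltKer s z x) ∂μ ≤
      s ^ 2 * (128 * tailBound z * ∫ x, (1 + x ^ 2) ^ 5 ∂μ) := by
    rw [← integral_const_mul, ← integral_const_mul]
    exact integral_mono j2 (((hmom 5).const_mul _).const_mul _) bd
  have hsq : tiltMoment μ s z ^ 2 ≤
      (s ^ 2 * (128 * tailBound z * ∫ x, (1 + x ^ 2) ^ 5 ∂μ)) * (1 + tiltMass μ s z) := by
    rw [← sq_abs]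
    refine (pow_le_pow_left₀ (abs_nonneg _) hA 2).trans (hCS.trans ?_)
    rw [hmass]
    exact mul_le_mul_of_nonneg_right hD (by linarith)
  rw [div_le_iff₀ hB0]
  refine hsq.trans ?_
  have hc : 0 ≤ s ^ 2 * (128 * tailBound z * ∫ x, (1 + x ^ 2) ^ 5 ∂μ) := by
    have := tailBound_pos z
    have : 0 ≤ ∫ x, (1 + x ^ 2) ^ 5 ∂μ := integral_nonneg fun x => by positivity
    positivity
  have h3 : 1 + tiltMass μ s z ≤ 3 * tiltMass μ s z := by linarith
  calc _ ≤ (s ^ 2 * (128 * tailBound z * ∫ x, (1 + x ^ 2) ^ 5 ∂μ)) * (3 * tiltMass μ s z) :=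
        mul_le_mul_of_nonneg_left h3 hc
    _ = _ := by ring

theorem tendsto_tiltGain_div (hmom : ∀ n : ℕ, Integrable (fun x => (1 + x ^ 2) ^ n) μ)
    (h0 : ∫ x, x ∂μ = 0) :
    Tendsto (fun s => tiltGain μ s / s ^ 2) (𝓝[≠] 0) (𝓝 ((∫ x, x ^ 2 ∂μ) ^ 2)) := by
  set v := ∫ x, x ^ 2 ∂μ with hv
  have i1 : Integrable (fun x => x) μ := by simpa using integrable_pow_of_even_moments hmom 1
  have e : ∀ s, tiltGain μ s / s ^ 2 =
      ∫ z, tiltMoment μ s z ^ 2 / tiltMass μ s z / s ^ 2 ∂gaussianReal 0 1 :=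
    fun s => (integral_div _ _).symm
  have e2 : v ^ 2 = ∫ z, z ^ 2 * v ^ 2 ∂gaussianReal 0 1 := by
    have := variance_fun_id_gaussianReal (μ := 0) (v := 1)
    rw [variance_of_integral_eq_zero (by fun_prop) (by simp)] at this
    rw [integral_mul_const, this]
    simp
  simp only [e]
  rw [e2]
  refine tendsto_integral_filter_of_dominated_convergence
    (fun z => (384 * ∫ x, (1 + x ^ 2) ^ 5 ∂μ) * tailBound z)
    (.of_forall fun s => Measurable.aestronglyMeasurable (by fun_prop)) ?_
    (integrable_tailBound.const_mul _) (ae_of_all _ fun z => ?_)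
  · have hsmall : ∀ᶠ s : ℝ in 𝓝[≠] 0, s ^ 2 * v < 1 := by
      refine nhdsWithin_le_nhds ?_
      have : Tendsto (fun s : ℝ => s ^ 2 * v) (𝓝 0) (𝓝 (0 ^ 2 * v)) :=
        Continuous.tendsto (by fun_prop) 0
      exact this.eventually_lt_const (by simp)
    filter_upwards [eventually_abs_le_one, self_mem_nhdsWithin, hsmall] with s hs hs0 hsv
    refine ae_of_all _ fun z => ?_
    have hs2 : 0 < s ^ 2 := by have : s ≠ 0 := hs0; positivity
    rw [Real.norm_of_nonneg (div_nonneg (div_nonneg (sq_nonneg _) (tiltMass_pos μ s z).le) hs2.le),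
      div_le_iff₀ hs2]
    linarith [tiltMoment_sq_div_le_sq_mul hmom h0 hs hsv.le z]
  · have i3 : Integrable (fun x => x * (1 + x ^ 2)) μ := by
      have := i1.add (integrable_pow_of_even_moments hmom 3)
      exact this.congr (ae_of_all _ fun x => by simp only [Pi.add_apply]; ring)
    have h1 := tendsto_integral_mul_tiltKer_sub i1 i3 z
    have h2 : Tendsto (fun s => tiltMass μ s z) (𝓝[≠] 0) (𝓝 1) := by
      have := (continuous_tiltMass (μ := μ) z).tendsto 0
      have h1 : tiltMass μ 0 z = 1 := by simp [tiltMass, tiltKer]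
      rw [h1] at this
      exact this.mono_left nhdsWithin_le_nhds
    have h3 := (h1.pow 2).div h2 one_ne_zero
    have e3 : (z * ∫ x, x * x ∂μ) ^ 2 / 1 = z ^ 2 * v ^ 2 := by
      rw [div_one, mul_pow, hv]; simp only [sq]
    rw [e3] at h3
    refine h3.congr fun s => ?_
    simp only [h0, sub_zero, Pi.div_apply, div_pow]
    rw [div_right_comm]
    rfl

end SmallSignal

theorem memLp_two_of_even_moments {μ : Measure ℝ}
    (hmom : ∀ n : ℕ, Integrable (fun x => (1 + x ^ 2) ^ n) μ) :
    MemLp id 2 μ :=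
  (memLp_two_iff_integrable_sq measurable_id.aestronglyMeasurable).2
    (integrable_pow_of_even_moments hmom 2)

theorem tiltGain_zero {μ : Measure ℝ} (h0 : ∫ x, x ∂μ = 0) : tiltGain μ 0 = 0 := by
  simp [tiltGain, tiltMoment, tiltKer, h0]

section AdditiveRate

variable {μ : Measure ℝ} [IsProbabilityMeasure μ]

theorem mutualInfo_add_ne_top {θ : ℝ≥0} (hθ : θ ≠ 0) (hm : MemLp id 2 μ)
    (h0 : ∫ x, x ∂μ = 0) :
    mutualInfo (μ.prod (gaussianReal 0 θ)) Prod.fst (fun p => p.1 + p.2) ≠ ∞ :=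
  ne_top_of_le_ne_top ENNReal.ofReal_ne_top
    (le_self_add.trans (mutualInfo_add_klDiv hθ hm h0).le)

theorem toReal_mutualInfo_add {θ : ℝ≥0} (hθ : θ ≠ 0) (hm : MemLp id 2 μ)
    (h0 : ∫ x, x ∂μ = 0) :
    (mutualInfo (μ.prod (gaussianReal 0 θ)) Prod.fst (fun p => p.1 + p.2)).toReal =
      (√θ)⁻¹ ^ 2 * (∫ x, x ^ 2 ∂μ) / 2 - tiltKL μ (√θ)⁻¹ := by
  have h := mutualInfo_add_klDiv hθ hm h0
  have hk : klDiv ((μ.prod (gaussianReal 0 θ)).map (fun p => p.1 + p.2)) (gaussianReal 0 θ) ≠ ∞ :=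
    ne_top_of_le_ne_top ENNReal.ofReal_ne_top (le_add_self.trans h.le)
  have hv : 0 ≤ ∫ x, x ^ 2 ∂μ := integral_nonneg fun x => sq_nonneg x
  have := congrArg ENNReal.toReal h
  rw [ENNReal.toReal_add (mutualInfo_add_ne_top hθ hm h0) hk, toReal_klDiv_map_add hθ,
    integral_klFun_outDensity hθ, ENNReal.toReal_ofReal (by positivity)] at this
  rw [← sub_eq_of_eq_add this.symm, inv_pow, Real.sq_sqrt θ.coe_nonneg]
  congr 1
  field_simp

/-- The additive rate-distortion function has slope `-1/(2σ²)` at zero rate. -/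
theorem tendsto_additiveRDF_div (hmom : ∀ n : ℕ, Integrable (fun x => (1 + x ^ 2) ^ n) μ)
    (h0 : ∫ x, x ∂μ = 0) (hv : 0 < ∫ x, x ^ 2 ∂μ) :
    Tendsto (fun D => (additiveRDF μ D).toReal / ((∫ x, x ^ 2 ∂μ) - D)) (𝓝[<] (∫ x, x ^ 2 ∂μ))
      (𝓝 (1 / (2 * ∫ x, x ^ 2 ∂μ))) := by
  have hm := memLp_two_of_even_moments hmom
  have hlow : ∀ θ : ℝ≥0, θ ≠ 0 → (∫ x, x ^ 2 ∂μ) ^ 2 ≤ tiltGain μ (√θ)⁻¹ * ((∫ x, x ^ 2 ∂μ) + θ) :=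
    fun θ hθ => by
      rw [← outGain_eq_tiltGain hθ]; exact sq_le_outGain_mul hθ hm h0 hv
  have hg := tendsto_tiltGain_div hmom h0
  have hk := tendsto_tiltKL_div hmom h0
  set v := ∫ x, x ^ 2 ∂μ with hvdef
  have hq : Tendsto (fun s => (s ^ 2 * v / 2 - tiltKL μ s) / tiltGain μ s) (𝓝[≠] 0)
      (𝓝 (1 / (2 * v))) := by
    have h1 := ((tendsto_const_nhds (x := v / 2)).sub hk).div hg (by positivity)
    have e : (v / 2 - 0) / v ^ 2 = 1 / (2 * v) := by field_simp; ring
    rw [e] at h1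
    refine h1.congr' ?_
    filter_upwards [self_mem_nhdsWithin] with s hs
    have hs' : s ^ 2 ≠ 0 := pow_ne_zero 2 hs
    have e1 : v / 2 - tiltKL μ s / s ^ 2 = (s ^ 2 * v / 2 - tiltKL μ s) / s ^ 2 := by
      rw [sub_div, mul_div_assoc, mul_div_cancel_left₀ _ hs']
    simp only [Pi.div_apply]
    rw [e1, div_div_div_cancel_right₀ hs']
  rw [Metric.tendsto_nhds]
  intro ε hε
  have hev := (Metric.tendsto_nhds.1 hq) (ε / 2) (by positivity)
  rw [eventually_nhdsWithin_iff, Metric.eventually_nhds_iff] at hev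
  obtain ⟨δ, hδ, hclose⟩ := hev
  set s₀ := min δ 1
  have hs₀ : 0 < s₀ := lt_min hδ one_pos
  have hs₁ : s₀ ≤ 1 := min_le_right _ _
  set η := v ^ 2 / (v + 1 / s₀ ^ 2) with hη
  have hη0 : 0 < η := by positivity
  have hη1 : η ≤ v ^ 2 / (v + 1) := by
    refine div_le_div_of_nonneg_left (by positivity) (by positivity) ?_
    have : 1 ≤ 1 / s₀ ^ 2 := by
      rw [le_div_iff₀ (by positivity)]; nlinarith
    linarith
  have hI : Set.Ioo (v - η) v ∈ 𝓝[<] v := Ioo_mem_nhdsLT (by linarith)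
  filter_upwards [hI] with D hD
  have hDv : 0 < v - D := by linarith [hD.2]
  -- all admissible noise variances are in the small-signal regime
  have hall : ∀ θ : ℝ≥0, 0 < θ →
      minMSE (μ.prod (gaussianReal 0 θ)) Prod.fst (fun p => p.1 + p.2) = D →
      |(mutualInfo (μ.prod (gaussianReal 0 θ)) Prod.fst (fun p => p.1 + p.2)).toReal / (v - D)
        - 1 / (2 * v)| < ε / 2 := by
    intro θ hθ hMD
    have hθ0 : θ ≠ 0 := hθ.ne'
    have hθr : (0 : ℝ) < θ := hθ
    rw [minMSE_add_eq hθ0 hm h0, outGain_eq_tiltGain hθ0] at hMD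
    have hGD : tiltGain μ (√θ)⁻¹ = v - D := by linarith
    have hs : 0 < (√(θ : ℝ))⁻¹ := inv_pos.2 (Real.sqrt_pos.2 hθr)
    have hslt : (√(θ : ℝ))⁻¹ < s₀ := by
      by_contra hcon
      push Not at hcon
      have h1 : (θ : ℝ) ≤ 1 / s₀ ^ 2 := by
        have h2 := pow_le_pow_left₀ hs₀.le hcon 2
        rw [inv_pow, Real.sq_sqrt θ.coe_nonneg, le_inv_comm₀ (by positivity) hθr] at h2
        simpa using h2
      have h3 := hlow θ hθ0
      rw [hGD] at h3
      have h4 : (v - D) * (v + θ) ≤ (v - D) * (v + 1 / s₀ ^ 2) := by gcongr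
      have h5 : (v - D) * (v + 1 / s₀ ^ 2) < η * (v + 1 / s₀ ^ 2) := by
        have : v - D < η := by linarith [hD.1]
        gcongr
      rw [hη, div_mul_cancel₀ _ (by positivity)] at h5
      linarith
    have := hclose (y := (√(θ : ℝ))⁻¹)
      (by rw [Real.dist_eq, sub_zero, abs_of_pos hs]; exact hslt.trans_le (min_le_left _ _)) hs.ne'
    rw [Real.dist_eq, hGD] at this
    rwa [toReal_mutualInfo_add hθ0 hm h0]
  -- an admissible noise variance exists
  obtain ⟨θ₁, hθ₁, hD₁⟩ : ∃ θ : ℝ≥0, 0 < θ ∧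
      minMSE (μ.prod (gaussianReal 0 θ)) Prod.fst (fun p => p.1 + p.2) = D := by
    have hG1 : v ^ 2 / (v + 1) ≤ tiltGain μ 1 := by
      rw [div_le_iff₀ (by positivity)]
      simpa using hlow 1 one_ne_zero
    obtain ⟨s, hs, hsD⟩ := intermediate_value_Icc (zero_le_one (α := ℝ)) (continuousOn_tiltGain hmom)
      (show v - D ∈ Set.Icc (tiltGain μ 0) (tiltGain μ 1) from
        ⟨by rw [tiltGain_zero h0]; exact hDv.le, by linarith [hD.1]⟩)
    have hs0 : 0 < s := by
      refine lt_of_le_of_ne hs.1 fun h => ?_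
      rw [← h, tiltGain_zero h0] at hsD
      linarith
    have hpos : 0 < (s ^ 2)⁻¹ := by positivity
    obtain ⟨θ, hθ⟩ : ∃ θ : ℝ≥0, (θ : ℝ) = (s ^ 2)⁻¹ := ⟨_, Real.coe_toNNReal _ hpos.le⟩
    have hθ0 : 0 < θ := by rw [← NNReal.coe_pos, hθ]; exact hpos
    refine ⟨θ, hθ0, ?_⟩
    rw [minMSE_add_eq hθ0.ne' hm h0, outGain_eq_tiltGain hθ0.ne']
    have : (√(θ : ℝ))⁻¹ = s := by
      rw [hθ, Real.sqrt_inv, inv_inv, Real.sqrt_sq hs0.le]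
    rw [this, hsD]
    linarith
  have hle : additiveRDF μ D ≤
      mutualInfo (μ.prod (gaussianReal 0 θ₁)) Prod.fst (fun p => p.1 + p.2) :=
    iInf_le_of_le θ₁ (iInf_le_of_le hθ₁ (iInf_le _ hD₁))
  have hfin := mutualInfo_add_ne_top hθ₁.ne' hm h0
  have hfin' : additiveRDF μ D ≠ ∞ := ne_top_of_le_ne_top hfin hle
  have hge : ENNReal.ofReal ((1 / (2 * v) - ε / 2) * (v - D)) ≤ additiveRDF μ D := by
    refine le_iInf fun θ => le_iInf fun hθ => le_iInf fun hMD => ?_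
    rw [ENNReal.ofReal_le_iff_le_toReal (mutualInfo_add_ne_top hθ.ne' hm h0), ← le_div_iff₀ hDv]
    linarith [(abs_lt.1 (hall θ hθ hMD)).1]
  rw [ENNReal.ofReal_le_iff_le_toReal hfin', ← le_div_iff₀ hDv] at hge
  have hup : (additiveRDF μ D).toReal / (v - D) ≤ 1 / (2 * v) + ε / 2 := by
    have h1 := (abs_lt.1 (hall θ₁ hθ₁ hD₁)).2
    have h2 := div_le_div_of_nonneg_right (ENNReal.toReal_mono hfin hle) hDv.le
    linarith
  rw [Real.dist_eq, abs_lt]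
  constructor <;> linarith

end AdditiveRate

/-- A Donsker-Varadhan lower bound for the Kullback-Leibler divergence. -/
theorem ofReal_integral_le_klDiv {α : Type*} [MeasurableSpace α] {P Q : Measure α}
    [IsProbabilityMeasure P] [IsProbabilityMeasure Q] {f : α → ℝ} (hf : Measurable f)
    (hint : Integrable f P) (hexp : ∫⁻ a, ENNReal.ofReal (Real.exp (f a)) ∂Q ≤ 1) :
    ENNReal.ofReal (∫ a, f a ∂P) ≤ klDiv P Q := by
  by_cases htop : klDiv P Q = ∞
  · simp [htop]
  obtain ⟨hac, hllr⟩ := klDiv_ne_top_iff.1 htop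
  have hfQ : Integrable (fun a => Real.exp (f a)) Q :=
    (lintegral_ofReal_ne_top_iff_integrable (by fun_prop)
      (ae_of_all _ fun a => (Real.exp_pos _).le)).1 (ne_top_of_le_ne_top ENNReal.one_ne_top hexp)
  have hle : ∫ a, Real.exp (f a) ∂Q ≤ 1 := by
    rw [integral_eq_lintegral_of_nonneg_ae (ae_of_all _ fun a => (Real.exp_pos _).le)
      (by fun_prop)]
    exact ENNReal.toReal_le_of_le_ofReal zero_le_one (by simpa using hexp)
  have : IsProbabilityMeasure (Q.tilted f) := isProbabilityMeasure_tilted hfQ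
  have hac' : P ≪ Q.tilted f := hac.trans (absolutelyContinuous_tilted hfQ)
  have h1 := integral_llr_add_sub_measure_univ_nonneg hac'
    (integrable_llr_tilted_right hac hint hllr hfQ)
  rw [integral_llr_tilted_right hac hint hfQ hllr] at h1
  have h2 : Real.log (∫ a, Real.exp (f a) ∂Q) ≤ 0 :=
    Real.log_nonpos (integral_nonneg fun a => (Real.exp_pos _).le) hle
  rw [klDiv_of_ac_of_integrable hac hllr]
  refine ENNReal.ofReal_le_ofReal ?_
  simp only [probReal_univ] at h1 ⊢
  linarith

theorem mutualInfo_compProd {μ : Measure ℝ} [IsProbabilityMeasure μ] (κ : Kernel ℝ ℝ)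
    [IsMarkovKernel κ] :
    mutualInfo (μ ⊗ₘ κ) Prod.fst Prod.snd = klDiv (μ ⊗ₘ κ) (μ.prod (μ ⊗ₘ κ).snd) := by
  rw [mutualInfo]
  congr 1
  · exact Measure.map_id
  · congr 1
    exact Measure.fst_compProd μ κ

/-- Lower bound for the rate-distortion function from a sub-Gaussian feature `φ(X)`. -/
theorem le_rdf_of_subgaussian {μ : Measure ℝ} [IsProbabilityMeasure μ] (hm : MemLp id 2 μ)
    {φ g : ℝ → ℝ} (hφ : Measurable φ) (hφ2 : MemLp φ 2 μ) (hg : Integrable g μ) {V c w D : ℝ}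
    (hsub : ∀ t, ∫⁻ x, ENNReal.ofReal (Real.exp (t * φ x)) ∂μ ≤
      ENNReal.ofReal (Real.exp (t ^ 2 * V / 2)))
    (hc : 0 ≤ c) (hcw : 2 * c * V ≤ w) (hD : 0 ≤ D)
    (hfg : ∀ x y, g x - (x - y) ^ 2 ≤ 2 * φ x * y - w * y ^ 2) :
    ENNReal.ofReal (c * ((∫ x, g x ∂μ) - D)) ≤ rdf μ D := by
  refine le_iInf fun κ => le_iInf fun hκ => le_iInf fun hdist => ?_
  rw [mutualInfo_compProd]
  set P := μ ⊗ₘ κ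
  have hfst : P.map Prod.fst = μ := Measure.fst_compProd μ κ
  have hmp : MeasurePreserving Prod.fst P μ := ⟨measurable_fst, hfst⟩
  have hX : MemLp (fun p : ℝ × ℝ => p.1) 2 P := hm.comp_measurePreserving hmp
  have hφP : MemLp (fun p : ℝ × ℝ => φ p.1) 2 P := hφ2.comp_measurePreserving hmp
  have hgP : Integrable (fun p : ℝ × ℝ => g p.1) P := hmp.integrable_comp_of_integrable hg
  have hdi : Integrable (fun p : ℝ × ℝ => (p.1 - p.2) ^ 2) P :=
    (lintegral_ofReal_ne_top_iff_integrable (by fun_prop)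
      (ae_of_all _ fun a => sq_nonneg _)).1 (ne_top_of_le_ne_top ENNReal.ofReal_ne_top hdist)
  have hdL : MemLp (fun p : ℝ × ℝ => p.1 - p.2) 2 P :=
    (memLp_two_iff_integrable_sq (by fun_prop)).2 hdi
  have hY : MemLp (fun p : ℝ × ℝ => p.2) 2 P := by
    have := hX.sub hdL
    refine (memLp_congr_ae (ae_of_all _ fun p => ?_)).1 this
    simp
  have hdle : ∫ p : ℝ × ℝ, (p.1 - p.2) ^ 2 ∂P ≤ D := by
    rw [integral_eq_lintegral_of_nonneg_ae (ae_of_all _ fun a => sq_nonneg _) (by fun_prop)]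
    exact ENNReal.toReal_le_of_le_ofReal hD hdist
  set f : ℝ × ℝ → ℝ := fun p => c * (2 * φ p.1 * p.2 - w * p.2 ^ 2) with hf
  have hfm : Measurable f := by fun_prop
  have hfi : Integrable f P := by
    have h1 : Integrable (fun p : ℝ × ℝ => φ p.1 * p.2) P := hφP.integrable_mul hY
    refine (((h1.const_mul 2).sub (hY.integrable_sq.const_mul w)).const_mul c).congr
      (ae_of_all _ fun p => ?_)
    simp only [hf, Pi.sub_apply]
    ring
  have hlow : c * ((∫ x, g x ∂μ) - D) ≤ ∫ p, f p ∂P := by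
    have e1 : ∫ x, g x ∂μ = ∫ p : ℝ × ℝ, g p.1 ∂P := by
      have h : AEStronglyMeasurable g (P.map Prod.fst) := hfst ▸ hg.aestronglyMeasurable
      rw [← integral_map measurable_fst.aemeasurable h, hfst]
    have e2 : ∫ p : ℝ × ℝ, c * (g p.1 - (p.1 - p.2) ^ 2) ∂P ≤ ∫ p, f p ∂P :=
      integral_mono ((hgP.sub hdi).const_mul c) hfi
        fun p => mul_le_mul_of_nonneg_left (hfg p.1 p.2) hc
    rw [integral_const_mul, integral_sub hgP hdi, ← e1] at e2
    exact (mul_le_mul_of_nonneg_left (by linarith) hc).trans e2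
  have : IsProbabilityMeasure P.snd := Measure.isProbabilityMeasure_map (by fun_prop)
  refine (ENNReal.ofReal_le_ofReal hlow).trans (ofReal_integral_le_klDiv hfm hfi ?_)
  rw [lintegral_prod_symm _ (by fun_prop)]
  calc ∫⁻ y, ∫⁻ x, ENNReal.ofReal (Real.exp (f (x, y))) ∂μ ∂P.snd ≤ ∫⁻ y, 1 ∂P.snd := by
        refine lintegral_mono fun y => ?_
        have e : ∀ x, ENNReal.ofReal (Real.exp (f (x, y))) =
            ENNReal.ofReal (Real.exp (-(c * w * y ^ 2))) *
              ENNReal.ofReal (Real.exp (2 * c * y * φ x)) := fun x => by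
          rw [← ENNReal.ofReal_mul (Real.exp_pos _).le, ← Real.exp_add]
          congr 2; simp only [hf]; ring
        simp only [e]
        rw [lintegral_const_mul _ (by fun_prop)]
        refine (mul_le_mul_right (hsub (2 * c * y)) _).trans ?_
        rw [← ENNReal.ofReal_mul (Real.exp_pos _).le, ← Real.exp_add, ENNReal.ofReal_le_one,
          Real.exp_le_one_iff]
        have := mul_le_mul_of_nonneg_right hcw (mul_nonneg hc (sq_nonneg y))
        nlinarith
    _ = 1 := by simp

theorem klDiv_withDensity {α : Type*} [MeasurableSpace α] {P Q : Measure α} [IsFiniteMeasure P]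
    [IsFiniteMeasure Q] {g : α → ℝ} (hg : Measurable g) (hg0 : ∀ a, 0 ≤ g a)
    (hP : P = Q.withDensity fun a => ENNReal.ofReal (g a)) :
    klDiv P Q = ∫⁻ a, ENNReal.ofReal (klFun (g a)) ∂Q := by
  have hac : P ≪ Q := hP ▸ withDensity_absolutelyContinuous _ _
  rw [klDiv_eq_lintegral_klFun_of_ac hac, hP]
  refine lintegral_congr_ae ?_
  filter_upwards [Measure.rnDeriv_withDensity Q (f := fun a => ENNReal.ofReal (g a))
    (by fun_prop)] with a ha
  rw [ha, ENNReal.toReal_ofReal (hg0 a)]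

/-- The channel that reproduces `m` with probability `p x` and `0` otherwise. -/
def twoPointKernel (p : ℝ → ℝ) (hp : Measurable p) (m : ℝ) : Kernel ℝ ℝ where
  toFun x := ENNReal.ofReal (p x) • Measure.dirac m + ENNReal.ofReal (1 - p x) • Measure.dirac 0
  measurable' := by
    refine Measure.measurable_of_measurable_coe _ fun s hs => ?_
    simp only [Measure.coe_add, Measure.coe_smul, Pi.add_apply, Pi.smul_apply, smul_eq_mul]
    fun_prop

theorem lintegral_twoPointKernel (p : ℝ → ℝ) (hp : Measurable p) (m x : ℝ) (f : ℝ → ℝ≥0∞) :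
    ∫⁻ y, f y ∂twoPointKernel p hp m x =
      ENNReal.ofReal (p x) * f m + ENNReal.ofReal (1 - p x) * f 0 := by
  change ∫⁻ y, f y ∂(ENNReal.ofReal (p x) • Measure.dirac m +
    ENNReal.ofReal (1 - p x) • Measure.dirac 0) = _
  rw [lintegral_add_measure, lintegral_smul_measure, lintegral_smul_measure, lintegral_dirac,
    lintegral_dirac]
  rfl

theorem isMarkovKernel_twoPointKernel {p : ℝ → ℝ} (hp : Measurable p) (hp0 : ∀ x, 0 ≤ p x)
    (hp1 : ∀ x, p x ≤ 1) (m : ℝ) : IsMarkovKernel (twoPointKernel p hp m) := by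
  refine ⟨fun x => ⟨?_⟩⟩
  have := lintegral_twoPointKernel p hp m x 1
  simp only [Pi.one_apply, lintegral_one, mul_one] at this
  rw [this, ← ENNReal.ofReal_add (hp0 x) (by linarith [hp1 x])]
  simp

/-- Upper bound for the rate-distortion function near zero rate: reproduce the mean `m` of a law
with bounded density `q` with a small probability, and `0` otherwise. -/
theorem rdf_le_of_density {μ : Measure ℝ} [IsProbabilityMeasure μ] (hm2 : MemLp id 2 μ)
    {q : ℝ → ℝ} (hq : Measurable q) {C : ℝ} (hq0 : ∀ x, 0 ≤ q x) (hqC : ∀ x, q x ≤ C)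
    (hq1 : ∫ x, q x ∂μ = 1) {m : ℝ} (hm : ∫ x, x * q x ∂μ = m) (hm0 : m ≠ 0) {ε : ℝ} (hε : 0 < ε)
    (hεC : ε * C ≤ 1 / 2) :
    rdf μ ((∫ x, x ^ 2 ∂μ) - ε * m ^ 2) ≤
      ENNReal.ofReal (ε * (∫ x, klFun (q x) ∂μ) + 2 * ε ^ 2 * C ^ 2) := by
  have iq : Integrable q μ := Integrable.of_bound hq.aestronglyMeasurable C
    (ae_of_all _ fun x => by rw [Real.norm_of_nonneg (hq0 x)]; exact hqC x)
  have hC1 : 1 ≤ C := by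
    have := integral_mono iq (integrable_const C) hqC
    simpa [hq1] using this
  have hε2 : ε ≤ 1 / 2 := by nlinarith
  set p : ℝ → ℝ := fun x => ε * q x with hp
  have hpm : Measurable p := by fun_prop
  have hp0 : ∀ x, 0 ≤ p x := fun x => mul_nonneg hε.le (hq0 x)
  have hp1 : ∀ x, p x ≤ 1 := fun x => by
    have := mul_le_mul_of_nonneg_left (hqC x) hε.le
    simp only [hp]; linarith
  set κ := twoPointKernel p hpm m with hκ
  have : IsMarkovKernel κ := isMarkovKernel_twoPointKernel hpm hp0 hp1 m
  set ν : Measure ℝ := ENNReal.ofReal ε • Measure.dirac m +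
    ENNReal.ofReal (1 - ε) • Measure.dirac 0 with hν
  have hνint : ∀ f : ℝ → ℝ≥0∞, ∫⁻ y, f y ∂ν =
      ENNReal.ofReal ε * f m + ENNReal.ofReal (1 - ε) * f 0 := fun f => by
    rw [hν, lintegral_add_measure, lintegral_smul_measure, lintegral_smul_measure,
      lintegral_dirac, lintegral_dirac]
    rfl
  have hνfin : IsFiniteMeasure ν := ⟨by
    have := hνint 1
    simp only [Pi.one_apply, lintegral_one, mul_one] at this
    rw [this]; simp⟩
  have ip : Integrable p μ := iq.const_mul ε
  have ip' : Integrable (fun x => 1 - p x) μ := (integrable_const 1).sub ip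
  have hsnd : (μ ⊗ₘ κ).snd = ν := by
    refine Measure.ext_of_lintegral _ fun f hf => ?_
    rw [Measure.snd, lintegral_map hf measurable_snd, Measure.lintegral_compProd (by fun_prop),
      hνint]
    simp only [hκ, lintegral_twoPointKernel]
    rw [lintegral_add_left (by fun_prop), lintegral_mul_const _ (by fun_prop),
      lintegral_mul_const _ (by fun_prop), ← ofReal_integral_eq_lintegral_ofReal ip
        (ae_of_all _ hp0), ← ofReal_integral_eq_lintegral_ofReal ip'
        (ae_of_all _ fun x => sub_nonneg.2 (hp1 x))]
    have e1 : ∫ x, p x ∂μ = ε := by simp only [hp]; rw [integral_const_mul, hq1, mul_one]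
    rw [integral_sub (integrable_const 1) ip, e1]
    simp
  set g : ℝ × ℝ → ℝ := fun z => if z.2 = m then q z.1 else (1 - p z.1) / (1 - ε) with hg
  have hgm : Measurable g := Measurable.ite (measurable_snd (measurableSet_singleton m))
    (by fun_prop) (by fun_prop)
  have hg0 : ∀ z, 0 ≤ g z := fun z => by
    simp only [hg]
    split_ifs
    · exact hq0 _
    · exact div_nonneg (sub_nonneg.2 (hp1 _)) (by linarith)
  have hg1 : ∀ x, g (x, m) = q x := fun x => by simp [hg]
  have hg2 : ∀ x, g (x, 0) = (1 - p x) / (1 - ε) := fun x => by simp [hg, hm0.symm]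
  have hdens : μ ⊗ₘ κ = (μ.prod ν).withDensity fun z => ENNReal.ofReal (g z) := by
    refine Measure.ext_of_lintegral _ fun f hf => ?_
    rw [Measure.lintegral_compProd hf, lintegral_withDensity_eq_lintegral_mul _ (by fun_prop) hf,
      lintegral_prod _ (by fun_prop)]
    refine lintegral_congr fun x => ?_
    rw [hνint, hκ, lintegral_twoPointKernel]
    simp only [Pi.mul_apply, hg1, hg2]
    rw [← mul_assoc, ← mul_assoc, ← ENNReal.ofReal_mul hε.le,
      ← ENNReal.ofReal_mul (by linarith : 0 ≤ 1 - ε), mul_div_cancel₀ _ (by linarith : 1 - ε ≠ 0)]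
  have i1 : Integrable (fun x => x) μ := hm2.integrable (by norm_num)
  have i2 : Integrable (fun x => x ^ 2) μ := hm2.integrable_sq
  have i3 : Integrable (fun x => x * q x) μ := i1.mul_bdd (c := C) hq.aestronglyMeasurable
    (ae_of_all _ fun x => by rw [Real.norm_of_nonneg (hq0 x)]; exact hqC x)
  have hdist : ∫⁻ z, ENNReal.ofReal ((z.1 - z.2) ^ 2) ∂(μ ⊗ₘ κ) ≤
      ENNReal.ofReal ((∫ x, x ^ 2 ∂μ) - ε * m ^ 2) := by
    rw [Measure.lintegral_compProd (by fun_prop)]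
    simp only [hκ, lintegral_twoPointKernel]
    have e : ∀ x, ENNReal.ofReal (p x) * ENNReal.ofReal ((x - m) ^ 2) +
        ENNReal.ofReal (1 - p x) * ENNReal.ofReal ((x - 0) ^ 2) =
        ENNReal.ofReal (x ^ 2 + (ε * m ^ 2 * q x - 2 * ε * m * (x * q x))) := fun x => by
      have h1 : 0 ≤ 1 - p x := sub_nonneg.2 (hp1 x)
      rw [← ENNReal.ofReal_mul (hp0 x), ← ENNReal.ofReal_mul h1,
        ← ENNReal.ofReal_add (mul_nonneg (hp0 x) (sq_nonneg _)) (mul_nonneg h1 (sq_nonneg _))]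
      congr 1; simp only [hp]; ring
    simp only [e]
    have i4 : Integrable (fun x => ε * m ^ 2 * q x - 2 * ε * m * (x * q x)) μ :=
      (iq.const_mul _).sub (i3.const_mul _)
    have i5 : Integrable (fun x => x ^ 2 + (ε * m ^ 2 * q x - 2 * ε * m * (x * q x))) μ := i2.add i4
    rw [← ofReal_integral_eq_lintegral_ofReal i5, integral_add i2 i4,
      integral_sub (iq.const_mul _) (i3.const_mul _), integral_const_mul, integral_const_mul, hq1,
      hm]
    · refine ENNReal.ofReal_le_ofReal (le_of_eq ?_)
      ring
    · refine ae_of_all _ fun x => ?_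
      have h1 : 0 ≤ 1 - p x := sub_nonneg.2 (hp1 x)
      have h2 := mul_nonneg (hp0 x) (sq_nonneg (x - m))
      have h3 := mul_nonneg h1 (sq_nonneg x)
      simp only [hp, Pi.zero_apply] at h2 h3 ⊢
      nlinarith
  refine (iInf_le_of_le κ (iInf_le_of_le this (iInf_le _ hdist))).trans ?_
  have hkg : Measurable fun z => ENNReal.ofReal (klFun (g z)) :=
    (measurable_klFun.comp hgm).ennreal_ofReal
  rw [mutualInfo_compProd, hsnd, klDiv_withDensity hgm hg0 hdens, lintegral_prod _
    hkg.aemeasurable]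
  simp only [hνint, hg1, hg2]
  have ik : Integrable (fun x => klFun (q x)) μ := by
    refine Integrable.of_bound (measurable_klFun.comp hq).aestronglyMeasurable (C ^ 2 + 1)
      (ae_of_all _ fun x => ?_)
    rw [Real.norm_of_nonneg (klFun_nonneg (hq0 x))]
    rcases (hq0 x).eq_or_lt with h | h
    · rw [← h, klFun_zero]; nlinarith
    · refine (klFun_le_sq h).trans ?_
      nlinarith [hqC x]
  have hb : ∀ x, ENNReal.ofReal ε * ENNReal.ofReal (klFun (q x)) +
      ENNReal.ofReal (1 - ε) * ENNReal.ofReal (klFun ((1 - p x) / (1 - ε))) ≤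
      ENNReal.ofReal (ε * klFun (q x) + 2 * ε ^ 2 * C ^ 2) := fun x => by
    have h1 : 0 < 1 - p x := by
      have := mul_le_mul_of_nonneg_left (hqC x) hε.le
      simp only [hp]; linarith
    have h2 : 0 < 1 - ε := by linarith
    have h3 : 0 ≤ klFun ((1 - p x) / (1 - ε)) := klFun_nonneg (by positivity)
    rw [← ENNReal.ofReal_mul hε.le, ← ENNReal.ofReal_mul h2.le,
      ← ENNReal.ofReal_add (mul_nonneg hε.le (klFun_nonneg (hq0 x))) (mul_nonneg h2.le h3)]
    refine ENNReal.ofReal_le_ofReal (add_le_add le_rfl ?_)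
    have h4 := klFun_le_sq (div_pos h1 h2)
    have h5 : (1 - p x) / (1 - ε) - 1 = ε * (1 - q x) / (1 - ε) := by
      simp only [hp]; field_simp; ring
    have h6 : (1 - q x) ^ 2 ≤ C ^ 2 := by
      rw [sq_le_sq, abs_of_nonneg (by linarith : 0 ≤ C), abs_le]
      constructor <;> linarith [hq0 x, hqC x]
    rw [h5] at h4
    calc (1 - ε) * klFun ((1 - p x) / (1 - ε))
        ≤ (1 - ε) * (ε * (1 - q x) / (1 - ε)) ^ 2 := by gcongr
      _ = ε ^ 2 * (1 - q x) ^ 2 / (1 - ε) := by field_simp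
      _ ≤ ε ^ 2 * C ^ 2 / (1 / 2) := by gcongr; linarith
      _ = _ := by ring
  refine (lintegral_mono hb).trans ?_
  have i5 : Integrable (fun x => ε * klFun (q x) + 2 * ε ^ 2 * C ^ 2) μ :=
    (ik.const_mul ε).add (integrable_const _)
  rw [← ofReal_integral_eq_lintegral_ofReal i5, integral_add (ik.const_mul ε) (integrable_const _),
    integral_const_mul]
  · simp
  · refine ae_of_all _ fun x => ?_
    have := klFun_nonneg (hq0 x)
    simp only [Pi.zero_apply]
    positivity

theorem multiplicativeRateLoss_eq_div (μ : Measure ℝ) {v D : ℝ} (hD : D < v) :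
    multiplicativeRateLoss μ D =
      ((additiveRDF μ D).toReal / (v - D)) / ((rdf μ D).toReal / (v - D)) := by
  rw [multiplicativeRateLoss, div_div_div_cancel_right₀ (sub_pos.2 hD).ne']

/-- Upper bound for the slope of the rate-distortion function at zero rate. -/
theorem eventually_rdf_le {μ : Measure ℝ} [IsProbabilityMeasure μ] (hm2 : MemLp id 2 μ)
    {q : ℝ → ℝ} (hq : Measurable q) {C : ℝ} (hq0 : ∀ x, 0 ≤ q x) (hqC : ∀ x, q x ≤ C)
    (hq1 : ∫ x, q x ∂μ = 1) {m : ℝ} (hm : ∫ x, x * q x ∂μ = m) (hm0 : m ≠ 0) {a : ℝ}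
    (ha : (∫ x, klFun (q x) ∂μ) / m ^ 2 < a) :
    ∀ᶠ D in 𝓝[<] (∫ x, x ^ 2 ∂μ), rdf μ D ≤ ENNReal.ofReal (a * ((∫ x, x ^ 2 ∂μ) - D)) := by
  set v := ∫ x, x ^ 2 ∂μ
  set K := ∫ x, klFun (q x) ∂μ
  have hmm : 0 < m ^ 2 := by positivity
  have t1 : Tendsto (fun D => (v - D) / m ^ 2 * C) (𝓝[<] v) (𝓝 ((v - v) / m ^ 2 * C)) :=
    Tendsto.mono_left (Continuous.tendsto (by fun_prop) v) nhdsWithin_le_nhds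
  have t2 : Tendsto (fun D => K / m ^ 2 + 2 * (v - D) * C ^ 2 / m ^ 4) (𝓝[<] v)
      (𝓝 (K / m ^ 2 + 2 * (v - v) * C ^ 2 / m ^ 4)) :=
    Tendsto.mono_left (Continuous.tendsto (by fun_prop) v) nhdsWithin_le_nhds
  filter_upwards [self_mem_nhdsWithin, t1.eventually_lt_const (u := 1 / 2) (by simp),
    t2.eventually_lt_const (u := a) (by simpa using ha)] with D hD h1 h2
  have hDv : 0 < v - D := sub_pos.2 hD
  have hε : 0 < (v - D) / m ^ 2 := div_pos hDv hmm
  have h := rdf_le_of_density hm2 hq hq0 hqC hq1 hm hm0 hε h1.le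
  have e : v - (v - D) / m ^ 2 * m ^ 2 = D := by rw [div_mul_cancel₀ _ hmm.ne']; ring
  rw [e] at h
  refine h.trans (ENNReal.ofReal_le_ofReal ?_)
  have e2 : (v - D) / m ^ 2 * K + 2 * ((v - D) / m ^ 2) ^ 2 * C ^ 2 =
      (K / m ^ 2 + 2 * (v - D) * C ^ 2 / m ^ 4) * (v - D) := by field_simp
  rw [e2]
  exact mul_le_mul_of_nonneg_right h2.le hDv.le

theorem variance_id_eq_integral_sq {μ : Measure ℝ} (h0 : ∫ x, x ∂μ = 0) :
    Var[id; μ] = ∫ x, x ^ 2 ∂μ :=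
  variance_of_integral_eq_zero aemeasurable_id h0

theorem tendsto_multiplicativeRateLoss {μ : Measure ℝ} [IsProbabilityMeasure μ]
    (hmom : ∀ n : ℕ, Integrable (fun x => (1 + x ^ 2) ^ n) μ) (h0 : ∫ x, x ∂μ = 0)
    (hv : 0 < ∫ x, x ^ 2 ∂μ) {r : ℝ} (hr : r ≠ 0)
    (h : Tendsto (fun D => (rdf μ D).toReal / ((∫ x, x ^ 2 ∂μ) - D)) (𝓝[<] (∫ x, x ^ 2 ∂μ)) (𝓝 r)) :
    Tendsto (multiplicativeRateLoss μ) (𝓝[<] (∫ x, x ^ 2 ∂μ))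
      (𝓝 (1 / (2 * ∫ x, x ^ 2 ∂μ) / r)) := by
  refine ((tendsto_additiveRDF_div hmom h0 hv).div h hr).congr' ?_
  filter_upwards [self_mem_nhdsWithin] with D hD
  exact (multiplicativeRateLoss_eq_div μ hD).symm

theorem tendsto_multiplicativeRateLoss_atTop {μ : Measure ℝ} [IsProbabilityMeasure μ]
    (hmom : ∀ n : ℕ, Integrable (fun x => (1 + x ^ 2) ^ n) μ) (h0 : ∫ x, x ∂μ = 0)
    (hv : 0 < ∫ x, x ^ 2 ∂μ)
    (h : Tendsto (fun D => (rdf μ D).toReal / ((∫ x, x ^ 2 ∂μ) - D)) (𝓝[<] (∫ x, x ^ 2 ∂μ))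
      (𝓝[>] 0)) :
    Tendsto (multiplicativeRateLoss μ) (𝓝[<] (∫ x, x ^ 2 ∂μ)) atTop := by
  refine ((tendsto_additiveRDF_div hmom h0 hv).pos_mul_atTop (by positivity)
    h.inv_tendsto_nhdsGT_zero).congr' ?_
  filter_upwards [self_mem_nhdsWithin] with D hD
  rw [multiplicativeRateLoss_eq_div μ hD]
  rfl

theorem gaussianPDFReal_half_eq_mul {v : ℝ≥0} (hv : 0 < v) (m x : ℝ) :
    gaussianPDFReal m (v / 2) x =
      √2 * Real.exp ((2 * m * x - x ^ 2 / 2 - m ^ 2) / v) * gaussianPDFReal 0 v x := by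
  have hv' : (0 : ℝ) < v := hv
  have h2 : √(2 * Real.pi * v) = √2 * √(2 * Real.pi * ((v / 2 : ℝ≥0) : ℝ)) := by
    rw [← Real.sqrt_mul (by norm_num)]
    congr 1; push_cast; ring
  have hs : √2 ≠ 0 := by positivity
  rw [gaussianPDFReal, gaussianPDFReal, h2, mul_inv]
  have e : Real.exp (-(x - m) ^ 2 / (2 * ((v / 2 : ℝ≥0) : ℝ))) =
      Real.exp ((2 * m * x - x ^ 2 / 2 - m ^ 2) / v) * Real.exp (-(x - 0) ^ 2 / (2 * v)) := by
    rw [← Real.exp_add]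
    congr 1
    push_cast
    field_simp
    ring
  rw [e]
  field_simp

section Mixture

variable {P₀ P₁ v₀ v₁ : ℝ≥0}

theorem isProbabilityMeasure_gaussianMixture (hP : P₀ + P₁ = 1) :
    IsProbabilityMeasure (gaussianMixture P₀ P₁ v₀ v₁) := ⟨by
  simp only [gaussianMixture, Measure.add_apply, Measure.smul_apply, measure_univ]
  rw [← add_smul, hP, one_smul]⟩

theorem lintegral_gaussianMixture (f : ℝ → ℝ≥0∞) :
    ∫⁻ x, f x ∂gaussianMixture P₀ P₁ v₀ v₁ =
      P₀ * ∫⁻ x, f x ∂gaussianReal 0 v₀ + P₁ * ∫⁻ x, f x ∂gaussianReal 0 v₁ := by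
  rw [gaussianMixture, lintegral_add_measure, lintegral_smul_measure, lintegral_smul_measure]
  rfl

theorem integrable_gaussianMixture {f : ℝ → ℝ} (h0 : Integrable f (gaussianReal 0 v₀))
    (h1 : Integrable f (gaussianReal 0 v₁)) : Integrable f (gaussianMixture P₀ P₁ v₀ v₁) :=
  (h0.smul_measure_nnreal).add_measure (h1.smul_measure_nnreal)

theorem integral_gaussianMixture {f : ℝ → ℝ} (h0 : Integrable f (gaussianReal 0 v₀))
    (h1 : Integrable f (gaussianReal 0 v₁)) :
    ∫ x, f x ∂gaussianMixture P₀ P₁ v₀ v₁ =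
      P₀ * ∫ x, f x ∂gaussianReal 0 v₀ + P₁ * ∫ x, f x ∂gaussianReal 0 v₁ := by
  rw [gaussianMixture, integral_add_measure h0.smul_measure_nnreal h1.smul_measure_nnreal,
    integral_smul_nnreal_measure, integral_smul_nnreal_measure]
  rfl

theorem integrable_even_moment_gaussianReal (v : ℝ≥0) (n : ℕ) :
    Integrable (fun x : ℝ => (1 + x ^ 2) ^ n) (gaussianReal 0 v) := by
  simp only [add_pow, one_pow, one_mul, ← pow_mul]
  refine integrable_finsetSum _ fun k _ => Integrable.mul_const ?_ _
  have := memLp_id_gaussianReal (μ := 0) (v := v) ((2 * (n - k) : ℕ) : ℝ≥0)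
  exact (MemLp.integrable_norm_pow' (by exact_mod_cast this)).congr (ae_of_all _ fun x => by
    simp [pow_mul])

theorem even_moments_gaussianMixture (n : ℕ) :
    Integrable (fun x : ℝ => (1 + x ^ 2) ^ n) (gaussianMixture P₀ P₁ v₀ v₁) :=
  integrable_gaussianMixture (integrable_even_moment_gaussianReal _ _)
    (integrable_even_moment_gaussianReal _ _)

theorem integrable_id_gaussianReal (m : ℝ) (v : ℝ≥0) : Integrable (fun x => x) (gaussianReal m v) :=
  (memLp_id_gaussianReal 1).integrable (by simp)

theorem integrable_sq_gaussianReal (m : ℝ) (v : ℝ≥0) :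
    Integrable (fun x => x ^ 2) (gaussianReal m v) :=
  (memLp_id_gaussianReal (μ := m) (v := v) 2).integrable_sq

theorem integral_sq_gaussianReal (m : ℝ) (v : ℝ≥0) :
    ∫ x, x ^ 2 ∂gaussianReal m v = v + m ^ 2 := by
  have h := variance_eq_sub (memLp_id_gaussianReal (μ := m) (v := v) 2)
  rw [variance_id_gaussianReal] at h
  simp only [Pi.pow_apply, id_eq, integral_id_gaussianReal] at h
  linarith

theorem integral_id_gaussianMixture :
    ∫ x, x ∂gaussianMixture P₀ P₁ v₀ v₁ = 0 := by
  rw [integral_gaussianMixture (integrable_id_gaussianReal _ _) (integrable_id_gaussianReal _ _)]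
  simp

theorem integral_sq_gaussianMixture :
    ∫ x, x ^ 2 ∂gaussianMixture P₀ P₁ v₀ v₁ = P₀ * v₀ + P₁ * v₁ := by
  rw [integral_gaussianMixture (integrable_sq_gaussianReal _ _) (integrable_sq_gaussianReal _ _),
    integral_sq_gaussianReal, integral_sq_gaussianReal]
  simp

theorem lintegral_exp_mul_gaussianReal (v : ℝ≥0) (t : ℝ) :
    ∫⁻ x, ENNReal.ofReal (Real.exp (t * x)) ∂gaussianReal 0 v =
      ENNReal.ofReal (Real.exp (t ^ 2 * v / 2)) := by
  rw [← ofReal_integral_eq_lintegral_ofReal (integrable_exp_mul_gaussianReal t)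
    (ae_of_all _ fun x => (Real.exp_pos _).le)]
  have := congrFun (mgf_id_gaussianReal (μ := 0) (v := v)) t
  simp only [mgf, id_eq] at this
  rw [this]
  congr 2
  ring

theorem lintegral_exp_mul_gaussianMixture_le (hP : P₀ + P₁ = 1) (hv : v₀ ≤ v₁) (t : ℝ) :
    ∫⁻ x, ENNReal.ofReal (Real.exp (t * x)) ∂gaussianMixture P₀ P₁ v₀ v₁ ≤
      ENNReal.ofReal (Real.exp (t ^ 2 * v₁ / 2)) := by
  rw [lintegral_gaussianMixture, lintegral_exp_mul_gaussianReal, lintegral_exp_mul_gaussianReal]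
  have h : ENNReal.ofReal (Real.exp (t ^ 2 * v₀ / 2)) ≤
      ENNReal.ofReal (Real.exp (t ^ 2 * v₁ / 2)) := by
    have : (v₀ : ℝ) ≤ v₁ := hv
    gcongr
  refine (add_le_add_left (mul_le_mul_right h _) _).trans ?_
  rw [← add_mul, ← ENNReal.coe_add, hP]
  simp

theorem le_rdf_gaussianMixture (hP : P₀ + P₁ = 1) (hv : v₀ ≤ v₁) (hv₁ : 0 < v₁) {D : ℝ}
    (hD : 0 ≤ D) :
    ENNReal.ofReal (1 / (2 * v₁) * ((∫ x, x ^ 2 ∂gaussianMixture P₀ P₁ v₀ v₁) - D)) ≤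
      rdf (gaussianMixture P₀ P₁ v₀ v₁) D := by
  have := isProbabilityMeasure_gaussianMixture (v₀ := v₀) (v₁ := v₁) hP
  have hm := memLp_two_of_even_moments (even_moments_gaussianMixture (P₀ := P₀) (P₁ := P₁)
    (v₀ := v₀) (v₁ := v₁))
  have hv₁' : (0 : ℝ) < v₁ := hv₁
  refine le_rdf_of_subgaussian hm (φ := id) (w := 1) (V := v₁) measurable_id hm hm.integrable_sq
    (lintegral_exp_mul_gaussianMixture_le hP hv) (by positivity) (le_of_eq ?_) hD fun x y => ?_
  · field_simp
  · simp only [id_eq]; nlinarith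

/-- The density of the mixture. -/
def mixturePDF (P₀ P₁ v₀ v₁ : ℝ≥0) (x : ℝ) : ℝ :=
  P₀ * gaussianPDFReal 0 v₀ x + P₁ * gaussianPDFReal 0 v₁ x

@[fun_prop]
theorem measurable_mixturePDF : Measurable (mixturePDF P₀ P₁ v₀ v₁) := by
  unfold mixturePDF; fun_prop

theorem mixturePDF_pos (hP₁ : 0 < P₁) (hv₁ : 0 < v₁) (x : ℝ) : 0 < mixturePDF P₀ P₁ v₀ v₁ x :=
  add_pos_of_nonneg_of_pos (mul_nonneg P₀.coe_nonneg (gaussianPDFReal_nonneg _ _ _))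
    (mul_pos hP₁ (gaussianPDFReal_pos _ _ _ hv₁.ne'))

theorem gaussianMixture_eq_withDensity (hv₀ : 0 < v₀) (hv₁ : 0 < v₁) :
    gaussianMixture P₀ P₁ v₀ v₁ =
      volume.withDensity fun x => ENNReal.ofReal (mixturePDF P₀ P₁ v₀ v₁ x) := by
  have e : (fun x => ENNReal.ofReal (mixturePDF P₀ P₁ v₀ v₁ x)) =
      (P₀ : ℝ≥0∞) • gaussianPDF 0 v₀ + (P₁ : ℝ≥0∞) • gaussianPDF 0 v₁ := by
    ext x
    rw [mixturePDF, ENNReal.ofReal_add (mul_nonneg P₀.coe_nonneg (gaussianPDFReal_nonneg _ _ _))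
      (mul_nonneg P₁.coe_nonneg (gaussianPDFReal_nonneg _ _ _)),
      ENNReal.ofReal_mul P₀.coe_nonneg, ENNReal.ofReal_mul P₁.coe_nonneg]
    simp [gaussianPDF]
  rw [e, withDensity_add_left (by fun_prop), withDensity_smul _ (by fun_prop),
    withDensity_smul _ (by fun_prop), gaussianMixture, gaussianReal_of_var_ne_zero _ hv₀.ne',
    gaussianReal_of_var_ne_zero _ hv₁.ne']
  rfl

/-- The density of `N(m, v₁/2)` with respect to the mixture. -/
def mixtureShift (P₀ P₁ v₀ v₁ : ℝ≥0) (m x : ℝ) : ℝ :=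
  gaussianPDFReal m (v₁ / 2) x / mixturePDF P₀ P₁ v₀ v₁ x

@[fun_prop]
theorem measurable_mixtureShift (m : ℝ) : Measurable (mixtureShift P₀ P₁ v₀ v₁ m) := by
  unfold mixtureShift; fun_prop

theorem mixtureShift_nonneg (hP₁ : 0 < P₁) (hv₁ : 0 < v₁) (m x : ℝ) :
    0 ≤ mixtureShift P₀ P₁ v₀ v₁ m x :=
  div_nonneg (gaussianPDFReal_nonneg _ _ _) (mixturePDF_pos hP₁ hv₁ x).le

theorem mixtureShift_le_exp (hP₁ : 0 < P₁) (hv₁ : 0 < v₁) (m x : ℝ) :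
    mixtureShift P₀ P₁ v₀ v₁ m x ≤
      √2 / P₁ * Real.exp ((2 * m * x - x ^ 2 / 2 - m ^ 2) / v₁) := by
  have hP₁' : (0 : ℝ) < P₁ := hP₁
  rw [mixtureShift, gaussianPDFReal_half_eq_mul hv₁, div_le_iff₀ (mixturePDF_pos hP₁ hv₁ x), mixturePDF]
  have h1 : 0 ≤ (P₀ : ℝ) * gaussianPDFReal 0 v₀ x :=
    mul_nonneg P₀.coe_nonneg (gaussianPDFReal_nonneg _ _ _)
  set E := Real.exp ((2 * m * x - x ^ 2 / 2 - m ^ 2) / v₁)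
  have h2 : 0 ≤ √2 / P₁ * E := by positivity
  calc √2 * E * gaussianPDFReal 0 v₁ x = √2 / P₁ * E * (P₁ * gaussianPDFReal 0 v₁ x) := by
        field_simp
    _ ≤ _ := mul_le_mul_of_nonneg_left (by linarith) h2

theorem mixtureShift_le (hP₁ : 0 < P₁) (hv₁ : 0 < v₁) (m x : ℝ) :
    mixtureShift P₀ P₁ v₀ v₁ m x ≤ √2 / P₁ * Real.exp (m ^ 2 / v₁) := by
  refine (mixtureShift_le_exp hP₁ hv₁ m x).trans ?_
  have hv₁' : (0 : ℝ) < v₁ := hv₁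
  have : (2 * m * x - x ^ 2 / 2 - m ^ 2) / (v₁ : ℝ) ≤ m ^ 2 / v₁ :=
    div_le_div_of_nonneg_right (by nlinarith [sq_nonneg (x - 2 * m)]) hv₁'.le
  gcongr

theorem gaussianReal_eq_withDensity_mixtureShift (hP₁ : 0 < P₁) (hv₀ : 0 < v₀) (hv₁ : 0 < v₁)
    (m : ℝ) :
    gaussianReal m (v₁ / 2) = (gaussianMixture P₀ P₁ v₀ v₁).withDensity
      fun x => ((mixtureShift P₀ P₁ v₀ v₁ m x).toNNReal : ℝ≥0∞) := by
  rw [gaussianMixture_eq_withDensity hv₀ hv₁, ← withDensity_mul _ (by fun_prop) (by fun_prop),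
    gaussianReal_of_var_ne_zero _ (by positivity)]
  congr 1
  ext x
  have h := mixturePDF_pos (P₀ := P₀) (v₀ := v₀) hP₁ hv₁ x
  rw [Pi.mul_apply, gaussianPDF]
  change _ = _ * ENNReal.ofReal _
  rw [← ENNReal.ofReal_mul h.le, mixtureShift, mul_div_cancel₀ _ h.ne']

theorem integrable_mul_mixtureShift (hP₁ : 0 < P₁) (hv₀ : 0 < v₀) (hv₁ : 0 < v₁) {m : ℝ}
    {f : ℝ → ℝ} (hf : Integrable f (gaussianReal m (v₁ / 2))) :
    Integrable (fun x => f x * mixtureShift P₀ P₁ v₀ v₁ m x) (gaussianMixture P₀ P₁ v₀ v₁) := by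
  rw [gaussianReal_eq_withDensity_mixtureShift (P₀ := P₀) hP₁ hv₀ hv₁ m,
    integrable_withDensity_iff_integrable_smul (by fun_prop)] at hf
  refine hf.congr (ae_of_all _ fun x => ?_)
  simp only [NNReal.smul_def, smul_eq_mul]
  rw [Real.coe_toNNReal _ (mixtureShift_nonneg hP₁ hv₁ m x), mul_comm]

theorem integral_mul_mixtureShift (hP₁ : 0 < P₁) (hv₀ : 0 < v₀) (hv₁ : 0 < v₁) (m : ℝ)
    (f : ℝ → ℝ) :
    ∫ x, f x * mixtureShift P₀ P₁ v₀ v₁ m x ∂gaussianMixture P₀ P₁ v₀ v₁ =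
      ∫ x, f x ∂gaussianReal m (v₁ / 2) := by
  rw [gaussianReal_eq_withDensity_mixtureShift (P₀ := P₀) hP₁ hv₀ hv₁ m,
    integral_withDensity_eq_integral_smul (by fun_prop)]
  refine integral_congr_ae (ae_of_all _ fun x => ?_)
  simp only [NNReal.smul_def, smul_eq_mul]
  rw [Real.coe_toNNReal _ (mixtureShift_nonneg hP₁ hv₁ m x), mul_comm]

theorem integral_klFun_mixtureShift_le (hP : P₀ + P₁ = 1) (hP₁ : 0 < P₁) (hv₀ : 0 < v₀)
    (hv₁ : 0 < v₁) (m : ℝ) :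
    ∫ x, klFun (mixtureShift P₀ P₁ v₀ v₁ m x) ∂gaussianMixture P₀ P₁ v₀ v₁ ≤
      Real.log (√2 / P₁) + m ^ 2 / (2 * v₁) := by
  have := isProbabilityMeasure_gaussianMixture (v₀ := v₀) (v₁ := v₁) hP
  have hP₁' : (0 : ℝ) < P₁ := hP₁
  have hv₁' : (0 : ℝ) < v₁ := hv₁
  set q := mixtureShift P₀ P₁ v₀ v₁ m
  set L : ℝ → ℝ := fun x =>
    Real.log (√2 / P₁) + (2 * m / v₁ * x - 1 / (2 * v₁) * x ^ 2 - m ^ 2 / v₁) with hL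
  have hqL : ∀ x, klFun (q x) ≤ L x * q x + (1 - q x) := fun x => by
    rw [klFun_apply]
    have hq0 : 0 ≤ q x := mixtureShift_nonneg hP₁ hv₁ m x
    rcases hq0.eq_or_lt with h | h
    · rw [← h]; simp
    · have h1 := Real.log_le_log h (mixtureShift_le_exp hP₁ hv₁ m x)
      rw [Real.log_mul (by positivity) (Real.exp_pos _).ne', Real.log_exp] at h1
      have h2 : Real.log (√2 / P₁) + (2 * m * x - x ^ 2 / 2 - m ^ 2) / v₁ = L x := by
        simp only [hL]; field_simp
      rw [h2] at h1
      have := mul_le_mul_of_nonneg_left h1 h.le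
      linarith
  have j1 := integrable_id_gaussianReal m (v₁ / 2)
  have j2 := integrable_sq_gaussianReal m (v₁ / 2)
  have j12 : Integrable (fun x => 2 * m / v₁ * x - 1 / (2 * v₁) * x ^ 2)
      (gaussianReal m (v₁ / 2)) := (j1.const_mul _).sub (j2.const_mul _)
  have j123 : Integrable (fun x => 2 * m / v₁ * x - 1 / (2 * v₁) * x ^ 2 - m ^ 2 / v₁)
      (gaussianReal m (v₁ / 2)) := j12.sub (integrable_const _)
  have jL : Integrable L (gaussianReal m (v₁ / 2)) := (integrable_const _).add j123
  have iL := integrable_mul_mixtureShift (P₀ := P₀) hP₁ hv₀ hv₁ jL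
  have iq : Integrable q (gaussianMixture P₀ P₁ v₀ v₁) := by
    simpa using integrable_mul_mixtureShift (P₀ := P₀) hP₁ hv₀ hv₁
      (integrable_const (1 : ℝ) (μ := gaussianReal m (v₁ / 2)))
  have eq1 : ∫ x, q x ∂gaussianMixture P₀ P₁ v₀ v₁ = 1 := by
    simpa using integral_mul_mixtureShift (P₀ := P₀) hP₁ hv₀ hv₁ m (fun _ => 1)
  have i1q : Integrable (fun x => 1 - q x) (gaussianMixture P₀ P₁ v₀ v₁) :=
    (integrable_const 1).sub iq
  have iLq : Integrable (fun x => L x * q x + (1 - q x)) (gaussianMixture P₀ P₁ v₀ v₁) :=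
    iL.add i1q
  have h := integral_mono_of_nonneg
    (ae_of_all _ fun x => klFun_nonneg (mixtureShift_nonneg hP₁ hv₁ m x))
    iLq (ae_of_all _ hqL)
  refine h.trans ?_
  rw [integral_add iL i1q, integral_mul_mixtureShift hP₁ hv₀ hv₁,
    integral_sub (integrable_const _) iq, eq1, integral_add (integrable_const _) j123,
    integral_sub j12 (integrable_const _), integral_sub (j1.const_mul _) (j2.const_mul _),
    integral_const_mul, integral_const_mul, integral_id_gaussianReal, integral_sq_gaussianReal]
  simp only [integral_const, probReal_univ, smul_eq_mul, one_mul]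
  have e : 2 * m / v₁ * m - 1 / (2 * v₁) * (((v₁ / 2 : ℝ≥0) : ℝ) + m ^ 2) - m ^ 2 / v₁ =
      m ^ 2 / (2 * v₁) - 1 / 4 := by
    push_cast; field_simp; ring
  linarith

theorem tendsto_rdf_div_gaussianMixture (hP : P₀ + P₁ = 1) (hP₁ : 0 < P₁) (hv₀ : 0 < v₀)
    (hv : v₀ ≤ v₁) :
    Tendsto (fun D => (rdf (gaussianMixture P₀ P₁ v₀ v₁) D).toReal /
        ((∫ x, x ^ 2 ∂gaussianMixture P₀ P₁ v₀ v₁) - D))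
      (𝓝[<] (∫ x, x ^ 2 ∂gaussianMixture P₀ P₁ v₀ v₁)) (𝓝 (1 / (2 * v₁))) := by
  have := isProbabilityMeasure_gaussianMixture (v₀ := v₀) (v₁ := v₁) hP
  have hv₁ : 0 < v₁ := hv₀.trans_le hv
  have hv₁' : (0 : ℝ) < v₁ := hv₁
  have hP₁' : (0 : ℝ) < P₁ := hP₁
  have hm := memLp_two_of_even_moments (even_moments_gaussianMixture (P₀ := P₀) (P₁ := P₁)
    (v₀ := v₀) (v₁ := v₁))
  have hpos : 0 < ∫ x, x ^ 2 ∂gaussianMixture P₀ P₁ v₀ v₁ := by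
    rw [integral_sq_gaussianMixture]; positivity
  have hlow : ∀ D : ℝ, 0 ≤ D → _ := fun D hD => le_rdf_gaussianMixture hP hv hv₁ hD
  have hup : ∀ a, 1 / (2 * (v₁ : ℝ)) < a →
      ∀ᶠ D in 𝓝[<] (∫ x, x ^ 2 ∂gaussianMixture P₀ P₁ v₀ v₁),
      rdf (gaussianMixture P₀ P₁ v₀ v₁) D ≤
        ENNReal.ofReal (a * ((∫ x, x ^ 2 ∂gaussianMixture P₀ P₁ v₀ v₁) - D)) := by
    intro a ha
    have ht : Tendsto (fun m : ℝ => Real.log (√2 / P₁) / m ^ 2 + 1 / (2 * (v₁ : ℝ))) atTop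
        (𝓝 (0 + 1 / (2 * (v₁ : ℝ)))) :=
      (tendsto_const_nhds.div_atTop (tendsto_pow_atTop two_ne_zero)).add_const _
    obtain ⟨m, hma, hm0⟩ := ((ht.eventually_lt_const (u := a) (by simpa using ha)).and
      (eventually_gt_atTop 0)).exists
    refine eventually_rdf_le hm (measurable_mixtureShift (P₀ := P₀) (v₀ := v₀) m) (mixtureShift_nonneg hP₁ hv₁ m)
      (mixtureShift_le hP₁ hv₁ m) ?_ (m := m) ?_ hm0.ne' (lt_of_le_of_lt ?_ hma)
    · simpa using integral_mul_mixtureShift (P₀ := P₀) hP₁ hv₀ hv₁ m (fun _ => 1)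
    · rw [integral_mul_mixtureShift hP₁ hv₀ hv₁ m fun x => x]
      exact integral_id_gaussianReal
    · rw [div_le_iff₀ (by positivity)]
      refine (integral_klFun_mixtureShift_le hP hP₁ hv₀ hv₁ m).trans (le_of_eq ?_)
      field_simp
  set v := ∫ x, x ^ 2 ∂gaussianMixture P₀ P₁ v₀ v₁
  rw [tendsto_order]
  have hmem : Set.Ioo 0 v ∈ 𝓝[<] v := Ioo_mem_nhdsLT hpos
  have hfin : ∀ᶠ D in 𝓝[<] v, rdf (gaussianMixture P₀ P₁ v₀ v₁) D ≠ ∞ := by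
    filter_upwards [hup (1 / (2 * v₁) + 1) (by linarith)] with D hD
    exact ne_top_of_le_ne_top ENNReal.ofReal_ne_top hD
  refine ⟨fun a ha => ?_, fun a ha => ?_⟩
  · filter_upwards [hmem, hfin] with D hD hf
    have h := hlow D hD.1.le
    rw [ENNReal.ofReal_le_iff_le_toReal hf, ← le_div_iff₀ (sub_pos.2 hD.2)] at h
    exact ha.trans_le h
  · obtain ⟨b, hb, hba⟩ := exists_between ha
    filter_upwards [hmem, hup b hb] with D hD h
    have hvD : 0 < v - D := sub_pos.2 hD.2
    have hb0 : 0 < b := lt_trans (by positivity) hb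
    refine lt_of_le_of_lt ?_ hba
    rw [div_le_iff₀ hvD]
    exact ENNReal.toReal_le_of_le_ofReal (by positivity) h

end Mixture

/-- The rate-distortion function is positive if a bounded centered feature approximates the
source. -/
theorem rdf_pos_of_bounded {μ : Measure ℝ} [IsProbabilityMeasure μ] (hm : MemLp id 2 μ)
    {φ : ℝ → ℝ} (hφm : Measurable φ) {b : ℝ} (hb : 0 < b) (hφb : ∀ x, φ x ∈ Set.Icc (-b) b)
    (hφ0 : ∫ x, φ x ∂μ = 0) {D : ℝ} (hD0 : 0 ≤ D)
    (hD : ∫ x, (x - φ x) ^ 2 ∂μ < ((∫ x, x ^ 2 ∂μ) - D) / 2) : 0 < rdf μ D := by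
  obtain ⟨V, hV0, hsub⟩ : ∃ V : ℝ≥0, 0 < V ∧ HasSubgaussianMGF φ V μ := by
    refine ⟨_, ?_, hasSubgaussianMGF_of_mem_Icc_of_integral_eq_zero (μ := μ)
      hφm.aemeasurable (ae_of_all _ hφb) hφ0⟩
    have : b - -b ≠ 0 := by linarith
    have : 0 < ‖b - -b‖₊ := nnnorm_pos.2 this
    positivity
  have hV0' : (0 : ℝ) < V := hV0
  have hφ2 : MemLp φ 2 μ := memLp_of_bounded (ae_of_all _ hφb) hφm.aestronglyMeasurable 2
  have i2 : Integrable (fun x : ℝ => x ^ 2) μ := hm.integrable_sq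
  have iW : Integrable (fun x => (x - φ x) ^ 2) μ := (hm.sub hφ2).integrable_sq
  have hexp : ∀ t, ∫⁻ x, ENNReal.ofReal (Real.exp (t * φ x)) ∂μ ≤
      ENNReal.ofReal (Real.exp (t ^ 2 * V / 2)) := fun t => by
    rw [← ofReal_integral_eq_lintegral_ofReal (hsub.integrable_exp_mul t)
      (ae_of_all _ fun x => (Real.exp_pos _).le)]
    refine ENNReal.ofReal_le_ofReal ((hsub.mgf_le t).trans (le_of_eq ?_))
    rw [mul_comm (V : ℝ)]
  have hcV : 2 * (1 / (4 * (V : ℝ))) * V ≤ 1 / 2 := le_of_eq (by field_simp; norm_num)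
  have h := le_rdf_of_subgaussian (g := fun x => x ^ 2 - 2 * (x - φ x) ^ 2) (V := V) (D := D)
    hm hφm hφ2 (i2.sub (iW.const_mul 2)) hexp (by positivity) hcV hD0
    (fun x y => by nlinarith [sq_nonneg (y - 2 * (x - φ x))])
  refine lt_of_lt_of_le (ENNReal.ofReal_pos.2 (mul_pos (by positivity) ?_)) h
  rw [integral_sub i2 (iW.const_mul 2), integral_const_mul]
  linarith

/-- The symmetric law on `ℤ` with `P(|X| = k)` proportional to `2⁻ᵏ`. -/
def symmGeometric : Measure ℝ :=
  Measure.sum fun k : ℕ => ENNReal.ofReal ((1 / 2) ^ (k + 2)) •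
    (Measure.dirac (k : ℝ) + Measure.dirac (-(k : ℝ)))

theorem lintegral_symmGeometric (f : ℝ → ℝ≥0∞) :
    ∫⁻ x, f x ∂symmGeometric =
      ∑' k : ℕ, ENNReal.ofReal ((1 / 2) ^ (k + 2)) * (f k + f (-k)) := by
  rw [symmGeometric, lintegral_sum_measure]
  simp only [lintegral_smul_measure, lintegral_add_measure, lintegral_dirac, smul_eq_mul]

instance isProbabilityMeasure_symmGeometric : IsProbabilityMeasure symmGeometric := ⟨by
  have h := lintegral_symmGeometric 1
  simp only [Pi.one_apply, lintegral_one] at h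
  have e : ∀ k : ℕ, ENNReal.ofReal ((1 / 2) ^ (k + 2)) * (1 + 1) =
      ENNReal.ofReal ((1 / 2) ^ (k + 1)) := fun k => by
    rw [one_add_one_eq_two, ← ENNReal.ofReal_ofNat, ← ENNReal.ofReal_mul (by positivity)]
    congr 1; ring
  simp only [e] at h
  have hs : HasSum (fun k : ℕ => (1 / 2 : ℝ) ^ (k + 1)) 1 := by
    have := hasSum_geometric_two.mul_right (1 / 2)
    simpa [pow_succ] using this
  rw [h, ← ENNReal.ofReal_tsum_of_nonneg (fun k => by positivity) hs.summable, hs.tsum_eq]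
  simp⟩

theorem map_neg_symmGeometric : symmGeometric.map (fun x => -x) = symmGeometric := by
  refine Measure.ext_of_lintegral _ fun f hf => ?_
  rw [lintegral_map hf measurable_neg, lintegral_symmGeometric, lintegral_symmGeometric]
  simp only [neg_neg, add_comm]

theorem integral_odd_symmGeometric {f : ℝ → ℝ} (hf : Measurable f) (hodd : ∀ x, f (-x) = -f x) :
    ∫ x, f x ∂symmGeometric = 0 := by
  have h : ∫ x, f x ∂symmGeometric = ∫ x, f (-x) ∂symmGeometric := by
    conv_lhs => rw [← map_neg_symmGeometric]
    exact integral_map measurable_neg.aemeasurable hf.aestronglyMeasurable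
  simp only [hodd, integral_neg] at h
  linarith

theorem even_moments_symmGeometric (n : ℕ) :
    Integrable (fun x : ℝ => (1 + x ^ 2) ^ n) symmGeometric := by
  refine (lintegral_ofReal_ne_top_iff_integrable (by fun_prop)
    (ae_of_all _ fun x => by simp only [Pi.zero_apply]; positivity)).1 ?_
  rw [lintegral_symmGeometric]
  have e : ∀ k : ℕ, ENNReal.ofReal ((1 / 2) ^ (k + 2)) *
      (ENNReal.ofReal ((1 + (k : ℝ) ^ 2) ^ n) + ENNReal.ofReal ((1 + (-(k : ℝ)) ^ 2) ^ n)) =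
      ENNReal.ofReal ((1 + (k : ℝ) ^ 2) ^ n * (1 / 2) ^ (k + 1)) := fun k => by
    rw [neg_sq, ← ENNReal.ofReal_add (by positivity) (by positivity),
      ← ENNReal.ofReal_mul (by positivity)]
    congr 1; ring
  simp only [e]
  have hs : Summable fun k : ℕ => ((k : ℝ) + 1) ^ (2 * n) * (1 / 2 : ℝ) ^ (k + 1) := by
    have := (summable_nat_add_iff 1).2 (summable_pow_mul_geometric_of_norm_lt_one (R := ℝ) (2 * n)
      (r := 1 / 2) (by norm_num))
    simpa using this
  refine (Summable.of_nonneg_of_le (fun k => by positivity) (fun k => ?_) hs).tsum_ofReal_ne_top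
  rw [pow_mul]
  gcongr
  nlinarith [(k.cast_nonneg : (0 : ℝ) ≤ k)]

theorem le_measureReal_singleton_symmGeometric (k : ℕ) :
    (1 / 2) ^ (k + 2) ≤ symmGeometric.real {(k : ℝ)} := by
  rw [measureReal_def, ← ENNReal.ofReal_le_iff_le_toReal (measure_ne_top _ _), symmGeometric,
    Measure.sum_apply _ (measurableSet_singleton _)]
  refine le_trans ?_ (ENNReal.le_tsum k)
  simp only [Measure.smul_apply, Measure.add_apply, smul_eq_mul]
  rw [Measure.dirac_apply_of_mem (Set.mem_singleton _), mul_add, mul_one]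
  exact le_self_add

theorem integral_sq_symmGeometric_pos : 0 < ∫ x, x ^ 2 ∂symmGeometric := by
  rw [integral_pos_iff_support_of_nonneg (fun x => sq_nonneg x)
    (integrable_pow_of_even_moments even_moments_symmGeometric 2)]
  have h := le_measureReal_singleton_symmGeometric 1
  have h1 : symmGeometric {((1 : ℕ) : ℝ)} ≠ 0 := fun h0 => by
    rw [measureReal_def, h0] at h
    norm_num at h
  refine (pos_iff_ne_zero.2 h1).trans_le (measure_mono ?_)
  rintro x rfl
  simp

/-- A point mass of a source gives an upper bound for the slope at zero rate. -/
theorem eventually_rdf_le_of_atom {μ : Measure ℝ} [IsProbabilityMeasure μ] (hm2 : MemLp id 2 μ)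
    {m : ℝ} (hm0 : m ≠ 0) (hp : 0 < μ.real {m}) {a : ℝ}
    (ha : -Real.log (μ.real {m}) / m ^ 2 < a) :
    ∀ᶠ D in 𝓝[<] (∫ x, x ^ 2 ∂μ), rdf μ D ≤ ENNReal.ofReal (a * ((∫ x, x ^ 2 ∂μ) - D)) := by
  set p := μ.real {m} with hpdef
  set q : ℝ → ℝ := ({m} : Set ℝ).indicator fun _ => p⁻¹ with hq
  have hqm : Measurable q := measurable_const.indicator (measurableSet_singleton m)
  have hq0 : ∀ x, 0 ≤ q x := Set.indicator_nonneg fun _ _ => (inv_pos.2 hp).le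
  have hint : ∀ f : ℝ → ℝ, ∫ x, f x * q x ∂μ = f m := fun f => by
    have e : (fun x => f x * q x) = ({m} : Set ℝ).indicator fun _ => f m * p⁻¹ := by
      ext x
      by_cases h : x = m
      · simp [hq, h]
      · simp [hq, h]
    rw [e, integral_indicator (measurableSet_singleton m), setIntegral_const, smul_eq_mul,
      ← hpdef]
    field_simp
  have hq1 : ∫ x, q x ∂μ = 1 := by simpa using hint fun _ => 1
  have iq : Integrable q μ := (integrable_const _).indicator (measurableSet_singleton m)
  refine eventually_rdf_le hm2 hqm (C := p⁻¹) hq0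
    (fun x => Set.indicator_le_self' (fun _ _ => (inv_pos.2 hp).le) x) hq1
    (hint fun x => x) hm0 (lt_of_le_of_lt (le_of_eq ?_) ha)
  congr 1
  have e : ∀ x, klFun (q x) = -Real.log p * q x + (1 - q x) := fun x => by
    by_cases h : x = m
    · simp only [hq, h, Set.mem_singleton_iff, Set.indicator_of_mem, klFun_apply, Real.log_inv]
      ring
    · simp [hq, h, klFun_apply]
  simp only [e]
  have i1q : Integrable (fun x => 1 - q x) μ := (integrable_const 1).sub iq
  rw [integral_add (iq.const_mul _) i1q, integral_const_mul,
    integral_sub (integrable_const 1) iq, hq1]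
  simp

theorem rdf_symmGeometric_pos {D : ℝ} (hD0 : 0 ≤ D) (hD : D < ∫ x, x ^ 2 ∂symmGeometric) :
    0 < rdf symmGeometric D := by
  set v := ∫ x, x ^ 2 ∂symmGeometric
  have hm := memLp_two_of_even_moments even_moments_symmGeometric
  have i2 : Integrable (fun x : ℝ => x ^ 2) symmGeometric := hm.integrable_sq
  set φ : ℕ → ℝ → ℝ := fun n => (Set.Icc (-(n : ℝ)) n).indicator id with hφ
  have hφm : ∀ n, Measurable (φ n) := fun n => measurable_id.indicator measurableSet_Icc
  have hφb : ∀ (n : ℕ) (x : ℝ), φ n x ∈ Set.Icc (-(n : ℝ)) n := fun n x => by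
    by_cases h : x ∈ Set.Icc (-(n : ℝ)) n
    · simp only [hφ, Set.indicator_of_mem h]; exact h
    · simp [hφ, h]
  -- the truncation error vanishes
  have ht : Tendsto (fun n => ∫ x, (x - φ n x) ^ 2 ∂symmGeometric) atTop (𝓝 0) := by
    have := tendsto_integral_of_dominated_convergence (μ := symmGeometric)
      (F := fun n x => (x - φ n x) ^ 2) (f := fun _ => 0) (fun x => x ^ 2)
      (fun n => ((measurable_id.sub (hφm n)).pow_const 2).aestronglyMeasurable) i2
      (fun n => ae_of_all _ fun x => ?_) (ae_of_all _ fun x => ?_)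
    · simpa using this
    · rw [Real.norm_of_nonneg (sq_nonneg _)]
      by_cases h : x ∈ Set.Icc (-(n : ℝ)) n
      · simp only [hφ, Set.indicator_of_mem h, id_eq, sub_self, ne_eq, OfNat.ofNat_ne_zero, not_false_eq_true,
          zero_pow, sq_nonneg]
      · simp [hφ, Set.indicator_of_notMem h]
    · refine tendsto_const_nhds.congr' ?_
      filter_upwards [eventually_ge_atTop ⌈|x|⌉₊] with n hn
      have h : x ∈ Set.Icc (-(n : ℝ)) n := abs_le.1 (Nat.ceil_le.1 hn)
      simp [hφ, Set.indicator_of_mem h]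
  obtain ⟨n, hn, hn0⟩ := ((ht.eventually_lt_const (u := (v - D) / 2) (by linarith)).and
    (eventually_gt_atTop 0)).exists
  have hn' : (0 : ℝ) < n := by exact_mod_cast hn0
  have hodd : ∀ x, φ n (-x) = -φ n x := fun x => by
    have hiff : -x ∈ Set.Icc (-(n : ℝ)) n ↔ x ∈ Set.Icc (-(n : ℝ)) n := by
      simp only [Set.mem_Icc]; constructor <;> rintro ⟨h1, h2⟩ <;> constructor <;> linarith
    by_cases h : x ∈ Set.Icc (-(n : ℝ)) n
    · simp [hφ, Set.indicator_of_mem h, Set.indicator_of_mem (hiff.2 h)]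
    · simp [hφ, Set.indicator_of_notMem h, Set.indicator_of_notMem (mt hiff.1 h)]
  exact rdf_pos_of_bounded hm (hφm n) hn' (hφb n) (integral_odd_symmGeometric (hφm n) hodd) hD0 hn

theorem tendsto_rdf_div_symmGeometric :
    Tendsto (fun D => (rdf symmGeometric D).toReal / ((∫ x, x ^ 2 ∂symmGeometric) - D))
      (𝓝[<] (∫ x, x ^ 2 ∂symmGeometric)) (𝓝[>] 0) := by
  have hm := memLp_two_of_even_moments even_moments_symmGeometric
  have hup : ∀ a : ℝ, 0 < a → ∀ᶠ D in 𝓝[<] (∫ x, x ^ 2 ∂symmGeometric),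
      rdf symmGeometric D ≤ ENNReal.ofReal (a * ((∫ x, x ^ 2 ∂symmGeometric) - D)) := by
    intro a ha
    have ht : Tendsto (fun k : ℕ => ((k : ℝ) + 2) * Real.log 2 / (k : ℝ) ^ 2) atTop (𝓝 0) := by
      have h1 : Tendsto (fun k : ℕ => ((1 : ℝ) / k + 2 * (1 / (k : ℝ)) ^ 2) * Real.log 2) atTop
          (𝓝 ((0 + 2 * 0 ^ 2) * Real.log 2)) :=
        (tendsto_one_div_atTop_nhds_zero_nat.add
          ((tendsto_one_div_atTop_nhds_zero_nat.pow 2).const_mul 2)).mul_const _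
      simp only [ne_eq, OfNat.ofNat_ne_zero, not_false_eq_true, zero_pow, mul_zero, add_zero,
        zero_mul] at h1
      refine h1.congr' ?_
      filter_upwards [eventually_gt_atTop 0] with k hk
      have : (k : ℝ) ≠ 0 := by positivity
      field_simp
    obtain ⟨k, hka, hk⟩ := ((ht.eventually_lt_const ha).and (eventually_gt_atTop 0)).exists
    have hk' : (k : ℝ) ≠ 0 := by positivity
    have hlow := le_measureReal_singleton_symmGeometric k
    refine eventually_rdf_le_of_atom hm hk' (lt_of_lt_of_le (by positivity) hlow)
      (lt_of_le_of_lt ?_ hka)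
    refine div_le_div_of_nonneg_right ?_ (sq_nonneg _)
    have := Real.log_le_log (by positivity) hlow
    rw [Real.log_pow, one_div, Real.log_inv] at this
    push_cast at this
    linarith
  have hpos := integral_sq_symmGeometric_pos
  set v := ∫ x, x ^ 2 ∂symmGeometric
  have hmem : Set.Ioo 0 v ∈ 𝓝[<] v := Ioo_mem_nhdsLT hpos
  have hgt : ∀ᶠ D in 𝓝[<] v, 0 < (rdf symmGeometric D).toReal / (v - D) := by
    filter_upwards [hmem, hup 1 one_pos] with D hD hf
    exact div_pos (ENNReal.toReal_pos (rdf_symmGeometric_pos hD.1.le hD.2).ne'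
      (ne_top_of_le_ne_top ENNReal.ofReal_ne_top hf)) (sub_pos.2 hD.2)
  refine tendsto_nhdsWithin_iff.2 ⟨?_, hgt⟩
  rw [tendsto_order]
  refine ⟨fun a ha => ?_, fun a ha => ?_⟩
  · filter_upwards [hgt] with D hD
    exact ha.trans hD
  · obtain ⟨b, hb, hba⟩ := exists_between ha
    filter_upwards [hmem, hup b hb] with D hD h
    have hvD : 0 < v - D := sub_pos.2 hD.2
    refine lt_of_le_of_lt ?_ hba
    rw [div_le_iff₀ hvD]
    exact ENNReal.toReal_le_of_le_ofReal (by positivity) h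

end

theorem mainTheorem8 :
    (∀ lam σsq : ℝ≥0, 0 < lam → lam < 1 → 0 < σsq →
      ∃ L : ℝ≥0 → ℝ, Tendsto L atTop atTop ∧
        ∀ v₁ : ℝ≥0, σsq < v₁ →
          ∃ P₀ P₁ v₀ : ℝ≥0,
            0 < P₀ ∧ 0 < P₁ ∧ P₀ + P₁ = 1 ∧ 0 < v₀ ∧ v₀ < v₁ ∧
            P₀ * v₀ = lam * σsq ∧ P₁ * v₁ = (1 - lam) * σsq ∧
            MemLp id 2 (gaussianMixture P₀ P₁ v₀ v₁) ∧
            Var[id; gaussianMixture P₀ P₁ v₀ v₁] = (σsq : ℝ) ∧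
            Tendsto (multiplicativeRateLoss (gaussianMixture P₀ P₁ v₀ v₁))
              (𝓝[<] (σsq : ℝ)) (𝓝 (L v₁))) ∧
    (∃ μ : Measure ℝ, IsProbabilityMeasure μ ∧ MemLp id 2 μ ∧ 0 < Var[id; μ] ∧
      Tendsto (multiplicativeRateLoss μ) (𝓝[<] Var[id; μ]) atTop) := by
  constructor
  · intro lam σsq hlam hlam1 hσ
    have hσ' : (0 : ℝ) < σsq := hσ
    refine ⟨fun v => v / σsq, (NNReal.tendsto_coe_atTop.2 tendsto_id).atTop_div_const hσ',
      fun v₁ hv₁ => ?_⟩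
    have hv₁0 : 0 < v₁ := hσ.trans hv₁
    have hlam' : 0 < 1 - lam := tsub_pos_of_lt hlam1
    obtain ⟨P₁, hP₁⟩ : ∃ P₁ : ℝ≥0, P₁ = (1 - lam) * σsq / v₁ := ⟨_, rfl⟩
    have hP₁0 : 0 < P₁ := by rw [hP₁]; positivity
    have hPv₁ : P₁ * v₁ = (1 - lam) * σsq := by rw [hP₁]; exact div_mul_cancel₀ _ hv₁0.ne'
    have hP₁1 : P₁ < 1 := by
      rw [hP₁, div_lt_one hv₁0]
      exact (mul_le_of_le_one_left' tsub_le_self).trans_lt hv₁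
    obtain ⟨P₀, hP₀⟩ : ∃ P₀ : ℝ≥0, P₀ = 1 - P₁ := ⟨_, rfl⟩
    have hP₀0 : 0 < P₀ := by rw [hP₀]; exact tsub_pos_of_lt hP₁1
    have hP : P₀ + P₁ = 1 := by rw [hP₀]; exact tsub_add_cancel_of_le hP₁1.le
    obtain ⟨v₀, hv₀⟩ : ∃ v₀ : ℝ≥0, v₀ = lam * σsq / P₀ := ⟨_, rfl⟩
    have hv₀0 : 0 < v₀ := by rw [hv₀]; positivity
    have hPv₀ : P₀ * v₀ = lam * σsq := by rw [hv₀]; exact mul_div_cancel₀ _ hP₀0.ne'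
    have hsum : P₀ * v₀ + P₁ * v₁ = σsq := by
      rw [hPv₀, hPv₁, ← add_mul, add_tsub_cancel_of_le hlam1.le, one_mul]
    have hlt : v₀ < v₁ := by
      by_contra hcon
      push Not at hcon
      have h1 : v₁ ≤ σsq := by
        calc v₁ = P₀ * v₁ + P₁ * v₁ := by rw [← add_mul, hP, one_mul]
          _ ≤ P₀ * v₀ + P₁ * v₁ := by gcongr
          _ = σsq := hsum
      exact absurd h1 (not_le.2 hv₁)
    have := isProbabilityMeasure_gaussianMixture (v₀ := v₀) (v₁ := v₁) hP
    have hmom := even_moments_gaussianMixture (P₀ := P₀) (P₁ := P₁) (v₀ := v₀) (v₁ := v₁)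
    have h0 := integral_id_gaussianMixture (P₀ := P₀) (P₁ := P₁) (v₀ := v₀) (v₁ := v₁)
    have h2 : ∫ x, x ^ 2 ∂gaussianMixture P₀ P₁ v₀ v₁ = σsq := by
      rw [integral_sq_gaussianMixture]; exact_mod_cast hsum
    have hv₁' : (0 : ℝ) < v₁ := hv₁0
    refine ⟨P₀, P₁, v₀, hP₀0, hP₁0, hP, hv₀0, hlt, hPv₀, hPv₁, memLp_two_of_even_moments hmom,
      (variance_id_eq_integral_sq h0).trans h2, ?_⟩
    have h := tendsto_multiplicativeRateLoss hmom h0 (h2 ▸ hσ') (r := 1 / (2 * v₁))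
      (by positivity) (tendsto_rdf_div_gaussianMixture hP hP₁0 hv₀0 hlt.le)
    rw [h2] at h
    convert h using 2
    field_simp
  · have h0 : ∫ x, x ∂symmGeometric = 0 := integral_odd_symmGeometric measurable_id fun x => rfl
    refine ⟨symmGeometric, inferInstance, memLp_two_of_even_moments even_moments_symmGeometric, ?_⟩
    rw [variance_id_eq_integral_sq h0]
    exact ⟨integral_sq_symmGeometric_pos, tendsto_multiplicativeRateLoss_atTop
      even_moments_symmGeometric h0 integral_sq_symmGeometric_pos tendsto_rdf_div_symmGeometric⟩
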